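/- **Floating point model.** A real number is *representable* if it has the form $m2^e$ with $m,e\in\mathbb Z$. For $d\in\mathbb N$ and real $x$ let $\circ_d(x)$ be $x$ rounded to $d$ binary digits, ties to even: $\circ_d(0)=0$, and for $x\neq0$, $\circ_d(x)=q\,2^{e}$, where $e$ is the integer with $2^{d-1}\le |x|/2^{e}<2^{d}$ and $q$ is the integer nearest to $x/2^{e}$ (the even one in case of a tie). At working precision $d$ each operation $*\in\{+,-,\times,/\}$ applied to $x,y$ returns $\circ_d(\circ_d(x)*\circ_d(y))$, and $\mathtt{fac}(j)$ returns some number $j!\,(1+\eta)$ with $|\eta|\le2^{-d}$. **Data.** Let $t>0$, $a=\sqrt{t/2\pi}$, $\sigma\in\mathbb R$, $\varepsilon_4>0$, and let $L$ be a natural number with $3L<2a^2/25$. Put $A=9^{\sigma}$, $B_1=1$ if $\sigma>0$, and $A=2^{-\sigma}$, $B_1=2\sqrt{1-\log2}$ if $\sigma\le0$. Define $d^{(0)}_0=1$, $d^{(0)}_k=0$ for $k\ne0$ and, for $n\ge1$, $d^{(n)}_k=0$ for $k<0$ and for $k>3n/2$, $$2(3n-2k)\,d^{(n)}_k=\tfrac12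 d^{(n-1)}_k+(1-2\sigma)d^{(n-1)}_{k-1}-2(3n-2k)(3n-2k+1)d^{(n-1)}_{k-2}\qquad(0\le k<3n/2),$$ $$d^{(n)}_{3n/2}=-\sum_{k=0}^{3n/2-1}(-1)^{3n/2-k}\,d^{(n)}_k\,\frac{(3n-2k)!}{(3n/2-k)!}\qquad(n\text{ even}),$$ and let $$\gamma_{n,k}=\frac{\sqrt{2\pi}}{128}\Bigl(\frac{\pi a^2}{8}\Bigr)^{n/2}\frac{2^{2k}\varepsilon_4}{\Gamma\bigl(\frac{3n-2k+1}{2}\bigr)} .$$ **Procedure.** For $1\le n$ let $\mathtt{wpd}[n]$ be the least natural number $d\ge6$ such that $$2^d>40L^2\quad\text{and}\quad 2^d>(1+|\sigma|)\frac{A\,2^{13}}{\varepsilon_4}\Bigl(\frac{8}{\pi a^2B_1^2}\Bigr)^{n/2}\Gamma(n-\tfrac12)^{1/2}.$$ Compute $\mathtt{psigma}=1-(2\sigma)$ at working precision $\mathtt{wpd}[1]$. Put $\mathtt d[0,0]=1$ and $\mathtt d[0,-2]=\mathtt d[0,-1]=\mathtt d[0,1]=0$. For $n=1,\dots,L-1$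 (in this order), at working precision $\mathtt{wpd}[n]$, for $k=0,\dots,\lfloor3n/2\rfloor$ (in this order), with the integer $m=3n-2k$: * if $m\ne0$, compute $\mathtt{m1}=1/m$, $\mathtt{c1}=\mathtt{m1}/4$, $\mathtt{c2}=(\mathtt{psigma}\times\mathtt{m1})/2$, $\mathtt{c3}=-(m+1)$ (exact integer), and $\mathtt d[n,k]=(\mathtt{c3}\times\mathtt d[n-1,k-2]+\mathtt{c1}\times\mathtt d[n-1,k])+\mathtt{c2}\times\mathtt d[n-1,k-1]$; * if $m=0$, start with $\mathtt d[n,k]=0$ and, for $r=0,\dots,k-1$ in this order, compute $\mathtt{add}=\mathtt d[n,r]\times\bigl((1\times\mathtt{fac}(2k-2r))/\mathtt{fac}(k-r)\bigr)$ and replace $\mathtt d[n,k]$ by $\mathtt d[n,k]-(-1)^{k-r}\times\mathtt{add}$. Then put $\mathtt d[n,-2]=\mathtt d[n,-1]=\mathtt d[n,\lfloor3n/2\rfloor+1]=0$. **Proposition.** Assume $|\sigma|\le a/2$. Then for all integers $0\le n<L$ and $0\le k\le 3n/2$ the number $\mathtt d[n,k]$ computed by this procedure is representable and satisfies $\bigl|\mathtt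 d[n,k]-d^{(n)}_k\bigr|<\gamma_{n,k}$. -/

import Mathlib

namespace RiemannSiegel

noncomputable section

/-! ### Idealized multiple precision floating point arithmetic -/

/-- Representable numbers: the dyadic numbers `m * 2 ^ e`, including `0`. -/
def IsRepresentable (x : ℝ) : Prop :=
  ∃ m e : ℤ, x = (m : ℝ) * (2 : ℝ) ^ e

/-- The integer nearest to `y`; in case of a tie, the even one. -/
def roundEven (y : ℝ) : ℤ :=
  if Int.fract y < 1 / 2 then ⌊y⌋
  else if 1 / 2 < Int.fract y then ⌊y⌋ + 1
  else if Even ⌊y⌋ then ⌊y⌋ else ⌊y⌋ + 1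

/-- The rounded version of the real number `x` to `d` binary digits, with ties to even.
The exponent `e` is the one with `2 ^ (d - 1) ≤ |x| / 2 ^ e < 2 ^ d`. -/
def rnd (d : ℕ) (x : ℝ) : ℝ :=
  if x = 0 then 0
  else
    let e : ℤ := Int.log 2 |x| + 1 - (d : ℤ)
    (roundEven (x / (2 : ℝ) ^ e) : ℝ) * (2 : ℝ) ^ e

/-- The elementary operations at working precision `d`: the operands are rounded, the operation is
performed exactly, and the result is rounded. -/
def fadd (d : ℕ) (x y : ℝ) : ℝ := rnd d (rnd d x + rnd d y)

/-- Subtraction at working precision `d`. -/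
def fsub (d : ℕ) (x y : ℝ) : ℝ := rnd d (rnd d x - rnd d y)

/-- Multiplication at working precision `d`. -/
def fmul (d : ℕ) (x y : ℝ) : ℝ := rnd d (rnd d x * rnd d y)

/-- Division at working precision `d`. -/
def fdiv (d : ℕ) (x y : ℝ) : ℝ := rnd d (rnd d x / rnd d y)

/-- `fac d j` is the value that the system returns for `j!` at working precision `d`. The system
routine is correct when this value is `j! * (1 + η)` with `|η| ≤ 2 ^ (-d)`. -/
def IsFactorialRoutine (fac : ℕ → ℕ → ℝ) : Prop :=
  ∀ d j : ℕ, 1 ≤ d → |fac d j - (j.factorial : ℝ)| ≤ (j.factorial : ℝ) / 2 ^ d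

/-! ### The coefficients and the parameters of the problem -/

/-- One row of the exact recurrence: from `k ↦ d^{(n-1)}_k` to `k ↦ d^{(n)}_k`. -/
def exactRow (σ : ℝ) (n : ℕ) (prev : ℤ → ℝ) : ℤ → ℝ :=
  let gen : ℤ → ℝ := fun k =>
    if 0 ≤ k ∧ 2 * k < 3 * (n : ℤ) then
      ((1 / 2) * prev k + (1 - 2 * σ) * prev (k - 1)
        - 2 * (3 * (n : ℝ) - 2 * (k : ℝ)) * (3 * (n : ℝ) - 2 * (k : ℝ) + 1) * prev (k - 2))
        / (2 * (3 * (n : ℝ) - 2 * (k : ℝ)))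
    else 0
  fun k =>
    if 2 * k = 3 * (n : ℤ) then
      -∑ r ∈ Finset.range k.toNat, (-1 : ℝ) ^ (k.toNat - r) * gen (r : ℤ)
          * (((2 * k.toNat - 2 * r).factorial : ℝ) / ((k.toNat - r).factorial : ℝ))
    else gen k

/-- The coefficients `d^{(n)}_k`, for `n ≥ 0` and `k ∈ ℤ`. -/
def dCoeff (σ : ℝ) : ℕ → ℤ → ℝ
  | 0 => fun k => if k = 0 then 1 else 0
  | n + 1 => exactRow σ (n + 1) (dCoeff σ n)

/-- `a = √(t / 2π)`. -/
def rsA (t : ℝ) : ℝ := √(t / (2 * Real.pi))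

/-- The constant `A = A(σ)` of the bound
`|d^{(n)}_k| ≤ A 2 ^ k B₁ ^ (-n) (Γ(n + 1/2) / (3n - 2k)!) ^ (1/2)`. -/
def constA (σ : ℝ) : ℝ := if 0 < σ then (9 : ℝ) ^ σ else (2 : ℝ) ^ (-σ)

/-- The constant `B₁ = B₁(σ)` of the same bound. -/
def constB₁ (σ : ℝ) : ℝ := if 0 < σ then 1 else 2 * √(1 - Real.log 2)

/-- The tolerances `γ_{n,k}`. -/
def gammaTol (a ε₄ : ℝ) (n : ℕ) (k : ℤ) : ℝ :=
  √(2 * Real.pi) / 128 * (Real.pi * a ^ 2 / 8) ^ ((n : ℝ) / 2)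
    * ((2 : ℝ) ^ (2 * k) * ε₄ / Real.Gamma ((3 * (n : ℝ) - 2 * (k : ℝ) + 1) / 2))

/-- The working precision `wpd[n]` (only used for `n ≥ 1`, where `Γ(n - 1/2) > 0`). -/
def wpd (σ a ε₄ : ℝ) (L n : ℕ) : ℕ :=
  sInf {d : ℕ | 6 ≤ d ∧ 40 * (L : ℝ) ^ 2 < 2 ^ d ∧
    (1 + |σ|) * (constA σ * 2 ^ 13 / ε₄)
      * (8 / (Real.pi * a ^ 2 * constB₁ σ ^ 2)) ^ ((n : ℝ) / 2)
      * √(Real.Gamma ((n : ℝ) - 1 / 2)) < 2 ^ d}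

/-! ### The procedure -/

/-- The body of the inner loop in the case `m ≠ 0`, at working precision `d`:
`m1 = 1/m; c1 = m1/4; c2 = (psigma*m1)/2; c3 = -(m+1)`, and then `c3*x + c1*y + c2*z`, where
`x`, `y`, `z` are the stored values of `d[n-1,k-2]`, `d[n-1,k]`, `d[n-1,k-1]`. -/
def stepGen (d : ℕ) (psigma : ℝ) (m : ℤ) (x y z : ℝ) : ℝ :=
  let m1 := fdiv d 1 (m : ℝ)
  let c1 := fdiv d m1 4
  let c2 := fdiv d (fmul d psigma m1) 2
  let c3 := -((m : ℝ) + 1)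
  fadd d (fadd d (fmul d c3 x) (fmul d c1 y)) (fmul d c2 z)

/-- The body of the inner loop in the case `m = 0`, at working precision `d`: start with `0`, and
for `r = 0, …, k - 1` put `add = v[r]*(1.0*fac(2k-2r)/fac(k-r))` and subtract
`(-1)^(k-r)*add`. -/
def stepLast (d : ℕ) (fac : ℕ → ℕ → ℝ) (k : ℕ) (v : ℤ → ℝ) : ℝ :=
  (List.range k).foldl
    (fun (acc : ℝ) (r : ℕ) =>
      let add := fmul d (v (r : ℤ))
        (fdiv d (fmul d 1 (fac d (2 * k - 2 * r))) (fac d (k - r)))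
      fsub d acc (fmul d ((-1) ^ (k - r)) add)) 0

/-- One run of the outer loop at working precision `d`: from the stored row `d[n-1,·]` to the
stored row `d[n,·]`. Entries outside `0 ≤ k ≤ 3n/2` are stored as `0`. -/
def computedRow (d : ℕ) (fac : ℕ → ℕ → ℝ) (psigma : ℝ) (n : ℕ) (prev : ℤ → ℝ) : ℤ → ℝ :=
  let gen : ℤ → ℝ := fun k =>
    if 0 ≤ k ∧ 2 * k < 3 * (n : ℤ) then
      stepGen d psigma (3 * (n : ℤ) - 2 * k) (prev (k - 2)) (prev k) (prev (k - 1))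
    else 0
  fun k => if 2 * k = 3 * (n : ℤ) then stepLast d fac k.toNat gen else gen k

/-- `psigma = 1-(2*sigma)`, computed at working precision `wpd[1]`. -/
def psigmaVal (σ a ε₄ : ℝ) (L : ℕ) : ℝ :=
  fsub (wpd σ a ε₄ L 1) 1 (fmul (wpd σ a ε₄ L 1) 2 σ)

/-- The values `d[n,k]` stored by the procedure; row `n ≥ 1` is computed at working precision
`wpd[n]`. -/
def dComputed (σ a ε₄ : ℝ) (L : ℕ) (fac : ℕ → ℕ → ℝ) : ℕ → ℤ → ℝ
  | 0 => fun k => if k = 0 then 1 else 0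
  | n + 1 => computedRow (wpd σ a ε₄ L (n + 1)) fac (psigmaVal σ a ε₄ L) (n + 1)
      (dComputed σ a ε₄ L fac n)

end

end RiemannSiegel

/-! Write m = 3n - 2k. All sizes are measured against the weight w(m) = (2/5)^m / Γ((m+1)/2),
doubled at m = 0 (`wt`, `wtHat`). With 1/2 in place of 2/5 this is the m-dependence of the
tolerance, since 2^(2k) = 8^n (1/2)^m. Row n combines the entries m-3, m-1, m+1 of row n-1, and
log-convexity of Γ shows that the outer two cost O(√n) in weights and the middle one O(1 + |σ|). The
smaller base 2/5 pays for the sum at m = 0: (2j)!/j! · w(2j) = (16/25)^j w(0), a geometric series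
with sum at most 16/9 < 2. With base 1/2 all its terms would be equal.

Exact coefficients (`coeffBound`): |d| ≤ A K^n √(n!) ŵ(m), where ŵ is the doubled weight and K =
4√2/B₁. For |1/2 - σ| ≤ 3/2 the recurrence gives this directly, with A = 1. Other σ are reached by
`dCoeff_sub_one`, which expresses the difference of the coefficients for σ - 1 and σ through the
preceding row. A step down doubles A, a step up multiplies it by 9; hence 2^(-σ) and 9^σ.

Errors (`abs_dComputed_sub_le`): by induction on n the error is at most 0.49 T_n ŵ(m), with T_n =
`tolSize`. Inherited errors are multiplied by O(a), because √(3n/2) ≤ a/5 and |σ| ≤ a/2, while T_n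
grows by a√(8π) ≥ 5a per row. Fresh rounding errors are 2^(-d) times the terms of the exact
recurrence; the choice of `wpd` makes them a small multiple of n 2^(-n/2) T_n, because (4√2/B₁) · B₁
is √2/2 times 8. Undoing the doubling gives 0.98 < 1. -/

namespace RiemannSiegel

noncomputable section

/-! ### Weights -/

/-- The weights `(2/5) ^ i / Γ((i+1)/2)` for `i ≥ 0`, extended by `0`. -/
def wt (i : ℤ) : ℝ := if i < 0 then 0 else (2 / 5 : ℝ) ^ i / Real.Gamma (((i : ℝ) + 1) / 2)

/-- The weights `wt` with the weight at `0` doubled. -/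
def wtHat (i : ℤ) : ℝ := if i = 0 then 2 * wt i else wt i

/-- Log-convexity of Γ at the midpoint of x and x + 1. -/
theorem Gamma_add_half_le {x : ℝ} (hx : 0 < x) :
    Real.Gamma (x + 1 / 2) ≤ √x * Real.Gamma x := by
  have h := Real.Gamma_mul_add_mul_le_rpow_Gamma_mul_rpow_Gamma (s := x) (t := x + 1)
    (a := 1 / 2) (b := 1 / 2) hx (by linarith) (by norm_num) (by norm_num) (by norm_num)
  have hG := Real.Gamma_pos_of_pos hx
  rw [Real.Gamma_add_one hx.ne', ← Real.sqrt_eq_rpow, ← Real.sqrt_eq_rpow,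
    Real.sqrt_mul hx.le] at h
  calc Real.Gamma (x + 1 / 2) = Real.Gamma (1 / 2 * x + 1 / 2 * (x + 1)) := by ring_nf
    _ ≤ _ := h
    _ = √x * (√(Real.Gamma x) * √(Real.Gamma x)) := by ring
    _ = _ := by rw [Real.mul_self_sqrt hG.le]

theorem Gamma_half_pos {i : ℤ} (hi : 0 ≤ i) : 0 < Real.Gamma (((i : ℝ) + 1) / 2) := by
  have : (0 : ℝ) ≤ i := by exact_mod_cast hi
  exact Real.Gamma_pos_of_pos (by linarith)

theorem wt_of_nonneg {i : ℤ} (hi : 0 ≤ i) :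
    wt i = (2 / 5 : ℝ) ^ i / Real.Gamma (((i : ℝ) + 1) / 2) := by
  rw [wt, if_neg (not_lt.mpr hi)]

theorem wt_of_neg {i : ℤ} (hi : i < 0) : wt i = 0 := by rw [wt, if_pos hi]

theorem wt_pos {i : ℤ} (hi : 0 ≤ i) : 0 < wt i := by
  rw [wt_of_nonneg hi]
  exact div_pos (by positivity) (Gamma_half_pos hi)

theorem wt_nonneg (i : ℤ) : 0 ≤ wt i := by
  rcases lt_or_ge i 0 with h | h
  · rw [wt_of_neg h]
  · exact (wt_pos h).le

theorem wtHat_of_ne {i : ℤ} (hi : i ≠ 0) : wtHat i = wt i := by rw [wtHat, if_neg hi]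

theorem wtHat_zero : wtHat 0 = 2 * wt 0 := by rw [wtHat, if_pos rfl]

theorem wtHat_of_neg {i : ℤ} (hi : i < 0) : wtHat i = 0 := by
  rw [wtHat_of_ne hi.ne, wt_of_neg hi]

theorem wt_le_wtHat (i : ℤ) : wt i ≤ wtHat i := by
  rw [wtHat]
  split_ifs
  · linarith [wt_nonneg i]
  · exact le_rfl

theorem wtHat_le (i : ℤ) : wtHat i ≤ 2 * wt i := by
  rw [wtHat]
  split_ifs
  · exact le_rfl
  · linarith [wt_nonneg i]

theorem wtHat_nonneg (i : ℤ) : 0 ≤ wtHat i := (wt_nonneg i).trans (wt_le_wtHat i)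

theorem wt_zero : wt 0 = 1 / √Real.pi := by
  rw [wt_of_nonneg le_rfl]
  simp [← Real.Gamma_one_half_eq]

theorem wt_one : wt 1 = 2 / 5 := by
  rw [wt_of_nonneg (by norm_num)]
  norm_num

theorem wt_add_two {i : ℤ} (hi : 0 ≤ i) : wt (i + 2) * ((i : ℝ) + 1) = 8 / 25 * wt i := by
  have h0 : (0 : ℝ) ≤ i := by exact_mod_cast hi
  have hG := Gamma_half_pos hi
  rw [wt_of_nonneg hi, wt_of_nonneg (by omega)]
  have : (((i + 2 : ℤ) : ℝ) + 1) / 2 = ((i : ℝ) + 1) / 2 + 1 := by push_cast; ring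
  rw [this, Real.Gamma_add_one (by positivity), zpow_add₀ (by norm_num)]
  field_simp
  norm_num

theorem wt_le_succ {i : ℤ} (hi : 0 ≤ i) : wt i ≤ 5 / 2 * √(((i : ℝ) + 1) / 2) * wt (i + 1) := by
  have h0 : (0 : ℝ) ≤ i := by exact_mod_cast hi
  have hG := Gamma_half_pos hi
  have hG' : 0 < Real.Gamma (((i : ℝ) + 1) / 2 + 1 / 2) := Real.Gamma_pos_of_pos (by positivity)
  have h := Gamma_add_half_le (x := ((i : ℝ) + 1) / 2) (by positivity)
  rw [wt_of_nonneg hi, wt_of_nonneg (by omega)]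
  have : (((i + 1 : ℤ) : ℝ) + 1) / 2 = ((i : ℝ) + 1) / 2 + 1 / 2 := by push_cast; ring
  rw [this, zpow_add₀ (by norm_num), zpow_one]
  rw [div_le_iff₀ hG]
  have hp : (0 : ℝ) < (2 / 5 : ℝ) ^ i := by positivity
  calc (2 / 5 : ℝ) ^ i = (2 / 5 : ℝ) ^ i / Real.Gamma (((i : ℝ) + 1) / 2 + 1 / 2)
        * Real.Gamma (((i : ℝ) + 1) / 2 + 1 / 2) := by field_simp
    _ ≤ (2 / 5 : ℝ) ^ i / Real.Gamma (((i : ℝ) + 1) / 2 + 1 / 2)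
        * (√(((i : ℝ) + 1) / 2) * Real.Gamma (((i : ℝ) + 1) / 2)) := by gcongr
    _ = _ := by ring

theorem succ_mul_wt_succ_le {i : ℤ} (hi : 0 ≤ i) :
    ((i : ℝ) + 1) * wt (i + 1) ≤ 4 / 5 * √(((i : ℝ) + 2) / 2) * wt i := by
  have h0 : (0 : ℝ) ≤ i := by exact_mod_cast hi
  have h1 := wt_le_succ (i := i + 1) (by omega)
  have h2 := wt_add_two hi
  rw [show i + 1 + 1 = i + 2 by ring] at h1
  push_cast at h1
  rw [show (i : ℝ) + 1 + 1 = i + 2 by ring] at h1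
  calc ((i : ℝ) + 1) * wt (i + 1)
      ≤ ((i : ℝ) + 1) * (5 / 2 * √(((i : ℝ) + 2) / 2) * wt (i + 2)) := by gcongr
    _ = 5 / 2 * √(((i : ℝ) + 2) / 2) * (wt (i + 2) * ((i : ℝ) + 1)) := by ring
    _ = _ := by rw [h2]; ring

/-- Pass from m-3 to m-1 by the functional equation of Γ, which yields a factor m-2, then to m by
log-convexity. The doubled weight occurs only at m = 3, where 2(m-2) ≤ m absorbs it. -/
theorem wtHat_sub_three_le {m : ℤ} (hm : 1 ≤ m) :
    wtHat (m - 3) ≤ 125 / 64 * √((m : ℝ) / 2) * wt m * (4 * m) := by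
  have h0 : (1 : ℝ) ≤ m := by exact_mod_cast hm
  have hn : 0 ≤ √((m : ℝ) / 2) * wt m := mul_nonneg (Real.sqrt_nonneg _) (wt_nonneg _)
  rcases lt_or_ge m 3 with h | h
  · rw [wtHat_of_neg (by omega)]
    have := wt_nonneg m
    positivity
  · have h3 : (3 : ℝ) ≤ m := by exact_mod_cast h
    have h1 := wt_le_succ (i := m - 1) (by omega)
    have h2 := wt_add_two (i := m - 3) (by omega)
    rw [show m - 3 + 2 = m - 1 by ring] at h2
    rw [show m - 1 + 1 = m by ring] at h1
    push_cast at h1 h2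
    rw [show (m : ℝ) - 1 + 1 = m by ring] at h1
    rw [show (m : ℝ) - 3 + 1 = m - 2 by ring] at h2
    have h4 : wt (m - 3) ≤ 25 / 8 * (m - 2) * (5 / 2 * √((m : ℝ) / 2) * wt m) := by
      have : wt (m - 3) = 25 / 8 * (m - 2) * wt (m - 1) := by linarith
      rw [this]
      exact mul_le_mul_of_nonneg_left h1 (by linarith)
    rcases eq_or_lt_of_le h with h' | h'
    · subst h'
      have := wtHat_le (3 - 3)
      rw [show ((3 : ℤ) : ℝ) = 3 by norm_num] at h4 hn ⊢
      generalize wtHat (3 - 3) = x at *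
      generalize wt (3 - 3) = y at *
      generalize √(3 / 2 : ℝ) = S at *
      linarith
    · rw [wtHat_of_ne (by omega)]
      nlinarith

theorem succ_mul_wtHat_succ_le {m : ℤ} (hm : 0 ≤ m) :
    ((m : ℝ) + 1) * wtHat (m + 1) ≤ 4 / 5 * √(((m : ℝ) + 2) / 2) * wt m := by
  rw [wtHat_of_ne (by omega)]
  exact succ_mul_wt_succ_le hm

theorem wtHat_pred_le_of_two_le {m : ℤ} (hm : 2 ≤ m) : wtHat (m - 1) ≤ 5 / 4 * wt m * m := by
  have h0 : (2 : ℝ) ≤ m := by exact_mod_cast hm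
  have h1 := wt_le_succ (i := m - 1) (by omega)
  rw [show m - 1 + 1 = m by ring] at h1
  push_cast at h1
  rw [show (m : ℝ) - 1 + 1 = m by ring] at h1
  rw [wtHat_of_ne (by omega)]
  have h2 : √((m : ℝ) / 2) ≤ m / 2 := Real.sqrt_le_iff.mpr ⟨by positivity, by nlinarith⟩
  nlinarith [wt_nonneg m]

theorem sqrt_pi_gt : (1767 / 1000 : ℝ) < √Real.pi :=
  Real.lt_sqrt_of_sq_lt (by nlinarith [Real.pi_gt_d2])

theorem wt_zero_lt : wt 0 < 566 / 1000 := by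
  rw [wt_zero, div_lt_iff₀ (by positivity)]
  nlinarith [sqrt_pi_gt]

/-- The constant is forced by m = 1, where the doubled weight enters: 2w(0)/w(1) = 5/√π < 2.83. For
m ≥ 2 the constant 5/4 suffices. -/
theorem wtHat_pred_le {m : ℤ} (hm : 1 ≤ m) : wtHat (m - 1) ≤ 283 / 100 * wt m * m := by
  rcases eq_or_lt_of_le hm with h | h
  · subst h
    have := wt_zero_lt
    norm_num [wtHat_zero, wt_one]
    linarith
  · have := wtHat_pred_le_of_two_le (m := m) (by omega)
    have h0 : (1 : ℝ) ≤ m := by exact_mod_cast hm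
    have := wt_nonneg m
    nlinarith [mul_nonneg this (by linarith : (0 : ℝ) ≤ m)]

/-- Passing from j to j + 1 multiplies the factorial ratio by 2(2j+1) and the weight by
(8/25)/(2j+1). -/
theorem factorial_ratio_mul_wt (j : ℕ) :
    ((2 * j).factorial : ℝ) / (j.factorial : ℝ) * wt (2 * j) = (16 / 25) ^ j * wt 0 := by
  induction j with
  | zero => simp
  | succ j ih =>
    have h := wt_add_two (i := 2 * j) (by positivity)
    have e : (2 * (j + 1 : ℕ) : ℤ) = 2 * j + 2 := by push_cast; ring
    rw [e, show 2 * (j + 1) = 2 * j + 1 + 1 by ring, Nat.factorial_succ, Nat.factorial_succ,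
      Nat.factorial_succ]
    push_cast at h ⊢
    have hj : ((j.factorial : ℕ) : ℝ) ≠ 0 := by positivity
    have hj1 : (j : ℝ) + 1 ≠ 0 := by positivity
    have hj2 : (2 * (j : ℝ) + 1) ≠ 0 := by positivity
    rw [pow_succ, mul_right_comm, ← ih]
    have h' : wt (2 * (j : ℤ) + 2) = 8 / 25 * wt (2 * j) / (2 * (j : ℝ) + 1) := by
      rw [← h]; field_simp
    rw [h']
    field_simp
    ring

theorem sum_pow_le (k : ℕ) : ∑ r ∈ Finset.range k, (16 / 25 : ℝ) ^ (k - r) ≤ 16 / 9 := by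
  have : ∑ r ∈ Finset.range k, (16 / 25 : ℝ) ^ (k - r) = 16 / 9 - 16 / 9 * (16 / 25) ^ k := by
    induction k with
    | zero => simp
    | succ k ih =>
      rw [Finset.sum_range_succ]
      have : ∑ r ∈ Finset.range k, (16 / 25 : ℝ) ^ (k + 1 - r)
          = 16 / 25 * ∑ r ∈ Finset.range k, (16 / 25 : ℝ) ^ (k - r) := by
        rw [Finset.mul_sum]
        refine Finset.sum_congr rfl fun r hr => ?_
        rw [show k + 1 - r = (k - r) + 1 by have := Finset.mem_range.mp hr; omega, pow_succ]
        ring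
      rw [this, ih, show k + 1 - k = 1 by omega, pow_succ]
      ring
  rw [this]
  have : (0 : ℝ) ≤ (16 / 25) ^ k := by positivity
  linarith

/-! ### Bounds for the terms of one row -/

section Row

variable {n : ℕ} {k : ℤ} {X : ℝ} {prev : ℤ → ℝ}

theorem abs_first_term_le (hX : 0 ≤ X) (h : ∀ k, |prev k| ≤ X * wtHat (3 * n - 2 * k))
    (hk0 : 0 ≤ k) (hk : 2 * k < 3 * ((n + 1 : ℕ) : ℤ)) :
    |prev k| ≤ 125 / 64 * √(3 * ((n : ℝ) + 1) / 2) * (X * wt (3 * ((n + 1 : ℕ) : ℤ) - 2 * k))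
      * (4 * (3 * ((n : ℝ) + 1) - 2 * k)) := by
  have h1 := wtHat_sub_three_le (m := 3 * ((n + 1 : ℕ) : ℤ) - 2 * k) (by omega)
  have hk0' : (0 : ℝ) ≤ k := by exact_mod_cast hk0
  have hk' : (2 * k : ℝ) < 3 * ((n : ℝ) + 1) := by exact_mod_cast hk
  have h3 := h k
  rw [show (3 * (n : ℤ) - 2 * k) = 3 * ((n + 1 : ℕ) : ℤ) - 2 * k - 3 by push_cast; ring] at h3
  have hw := wt_nonneg (3 * ((n + 1 : ℕ) : ℤ) - 2 * k)
  have h4 : √(((3 * ((n + 1 : ℕ) : ℤ) - 2 * k : ℤ) : ℝ) / 2) ≤ √(3 * ((n : ℝ) + 1) / 2) :=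
    Real.sqrt_le_sqrt (by push_cast; linarith)
  generalize wt (3 * ((n + 1 : ℕ) : ℤ) - 2 * k) = W at *
  push_cast at h1 h4
  have hm : 0 ≤ 4 * (3 * ((n : ℝ) + 1) - 2 * k) := by linarith
  calc |prev k| ≤ _ := h3
    _ ≤ X * (125 / 64 * √(3 * ((n : ℝ) + 1) / 2) * W * (4 * (3 * ((n : ℝ) + 1) - 2 * k))) := by
        refine mul_le_mul_of_nonneg_left (h1.trans ?_) hX
        gcongr
    _ = _ := by ring

/-- Only k ≥ 2 contributes, so m + 2 ≤ 3(n+1) and the same square root as in the first term serves.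
-/
theorem abs_third_term_le (hX : 0 ≤ X) (h : ∀ k, |prev k| ≤ X * wtHat (3 * n - 2 * k))
    (h0 : ∀ k < 0, prev k = 0) (hk : 2 * k ≤ 3 * ((n + 1 : ℕ) : ℤ)) :
    (3 * ((n : ℝ) + 1) - 2 * k + 1) * |prev (k - 2)|
      ≤ 4 / 5 * √(3 * ((n : ℝ) + 1) / 2) * (X * wt (3 * ((n + 1 : ℕ) : ℤ) - 2 * k)) := by
  have hw := wt_nonneg (3 * ((n + 1 : ℕ) : ℤ) - 2 * k)
  rcases lt_or_ge (k - 2) 0 with hk2 | hk2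
  · rw [h0 _ hk2, abs_zero, mul_zero]
    positivity
  have h1 := succ_mul_wtHat_succ_le (m := 3 * ((n + 1 : ℕ) : ℤ) - 2 * k) (by omega)
  have hk0' : (2 : ℝ) ≤ k := by exact_mod_cast (by omega : 2 ≤ k)
  have hk' : (2 * k : ℝ) ≤ 3 * ((n : ℝ) + 1) := by exact_mod_cast hk
  have h3 := h (k - 2)
  rw [show (3 * (n : ℤ) - 2 * (k - 2)) = 3 * ((n + 1 : ℕ) : ℤ) - 2 * k + 1 by push_cast; ring] at h3
  have h4 : √((((3 * ((n + 1 : ℕ) : ℤ) - 2 * k : ℤ) : ℝ) + 2) / 2) ≤ √(3 * ((n : ℝ) + 1) / 2) :=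
    Real.sqrt_le_sqrt (by push_cast; linarith)
  generalize wt (3 * ((n + 1 : ℕ) : ℤ) - 2 * k) = W at *
  push_cast at h1 h4
  have hm : 0 ≤ 3 * ((n : ℝ) + 1) - 2 * k + 1 := by linarith
  calc _ ≤ (3 * ((n : ℝ) + 1) - 2 * k + 1) * (X * wtHat (3 * ((n + 1 : ℕ) : ℤ) - 2 * k + 1)) := by
        gcongr
    _ = X * ((3 * ((n : ℝ) + 1) - 2 * k + 1) * wtHat (3 * ((n + 1 : ℕ) : ℤ) - 2 * k + 1)) := by ring
    _ ≤ X * (4 / 5 * √(3 * ((n : ℝ) + 1) / 2) * W) := by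
        refine mul_le_mul_of_nonneg_left (h1.trans ?_) hX
        gcongr
    _ = _ := by ring

theorem abs_second_term_le (hX : 0 ≤ X) (h : ∀ k, |prev k| ≤ X * wtHat (3 * n - 2 * k))
    (hk : 2 * k < 3 * ((n + 1 : ℕ) : ℤ)) :
    |prev (k - 1)| ≤ 283 / 100 * (X * wt (3 * ((n + 1 : ℕ) : ℤ) - 2 * k))
      * (3 * ((n : ℝ) + 1) - 2 * k) := by
  have h1 := wtHat_pred_le (m := 3 * ((n + 1 : ℕ) : ℤ) - 2 * k) (by omega)
  have h3 := h (k - 1)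
  rw [show (3 * (n : ℤ) - 2 * (k - 1)) = 3 * ((n + 1 : ℕ) : ℤ) - 2 * k - 1 by push_cast; ring] at h3
  push_cast at h1 h3 ⊢
  nlinarith [mul_le_mul_of_nonneg_left h1 hX]

theorem abs_second_term_le_of_two_le (hX : 0 ≤ X)
    (h : ∀ k, |prev k| ≤ X * wtHat (3 * n - 2 * k)) (hk : 2 * k + 2 ≤ 3 * ((n + 1 : ℕ) : ℤ)) :
    |prev (k - 1)| ≤ 5 / 4 * (X * wt (3 * ((n + 1 : ℕ) : ℤ) - 2 * k))
      * (3 * ((n : ℝ) + 1) - 2 * k) := by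
  have h1 := wtHat_pred_le_of_two_le (m := 3 * ((n + 1 : ℕ) : ℤ) - 2 * k) (by omega)
  have h3 := h (k - 1)
  rw [show (3 * (n : ℤ) - 2 * (k - 1)) = 3 * ((n + 1 : ℕ) : ℤ) - 2 * k - 1 by push_cast; ring] at h3
  push_cast at h1 h3 ⊢
  nlinarith [mul_le_mul_of_nonneg_left h1 hX]

end Row

/-! ### The exact recurrence -/

theorem dCoeff_of_neg (σ : ℝ) (n : ℕ) {k : ℤ} (hk : k < 0) : dCoeff σ n k = 0 := by
  cases n with
  | zero => simp [dCoeff, hk.ne]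
  | succ n =>
    simp only [dCoeff, exactRow]
    rw [if_neg (by omega), if_neg (by omega)]

theorem dCoeff_of_lt (σ : ℝ) (n : ℕ) {k : ℤ} (hk : 3 * (n : ℤ) < 2 * k) : dCoeff σ n k = 0 := by
  cases n with
  | zero =>
    have : k ≠ 0 := by rintro rfl; simp at hk
    simp [dCoeff, this]
  | succ n =>
    simp only [dCoeff, exactRow]
    rw [if_neg (by omega), if_neg (by omega)]

theorem dCoeff_succ_of_lt (σ : ℝ) (n : ℕ) {k : ℤ} (hk0 : 0 ≤ k)
    (hk : 2 * k < 3 * ((n + 1 : ℕ) : ℤ)) :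
    dCoeff σ (n + 1) k = dCoeff σ n k / (4 * (3 * ((n : ℝ) + 1) - 2 * k))
      + (1 / 2 - σ) * (dCoeff σ n (k - 1) / (3 * ((n : ℝ) + 1) - 2 * k))
      - (3 * ((n : ℝ) + 1) - 2 * k + 1) * dCoeff σ n (k - 2) := by
  have hm : (3 * ((n : ℝ) + 1) - 2 * k) ≠ 0 := by
    have : (2 * k : ℝ) < 3 * ((n : ℝ) + 1) := by exact_mod_cast hk
    linarith
  simp only [dCoeff, exactRow]
  rw [if_neg (by omega), if_pos ⟨hk0, hk⟩]
  push_cast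
  field_simp
  ring

/-- The recurrence holds at all integers `k` when both sides are multiplied by `3n - 2k`. -/
theorem dCoeff_recurrence (σ : ℝ) (n : ℕ) (k : ℤ) :
    (3 * ((n : ℝ) + 1) - 2 * k) * dCoeff σ (n + 1) k = 1 / 4 * dCoeff σ n k
      + (1 / 2 - σ) * dCoeff σ n (k - 1)
      - (3 * ((n : ℝ) + 1) - 2 * k) * (3 * ((n : ℝ) + 1) - 2 * k + 1) * dCoeff σ n (k - 2) := by
  rcases lt_or_ge k 0 with h0 | h0
  · simp [dCoeff_of_neg, h0, show k - 1 < 0 by omega, show k - 2 < 0 by omega]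
  rcases lt_trichotomy (2 * k) (3 * ((n + 1 : ℕ) : ℤ)) with h | h | h
  · rw [dCoeff_succ_of_lt σ n h0 h]
    have hm : (3 * ((n : ℝ) + 1) - 2 * k) ≠ 0 := by
      have : (2 * k : ℝ) < 3 * ((n : ℝ) + 1) := by exact_mod_cast h
      linarith
    field_simp
  · have hm : (3 * ((n : ℝ) + 1) - 2 * k) = 0 := by
      have : (2 * k : ℝ) = 3 * ((n : ℝ) + 1) := by exact_mod_cast h
      linarith
    rw [hm, dCoeff_of_lt σ n (k := k) (by omega), dCoeff_of_lt σ n (k := k - 1) (by omega)]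
    ring
  · rw [dCoeff_of_lt σ (n + 1) h, dCoeff_of_lt σ n (k := k) (by omega),
      dCoeff_of_lt σ n (k := k - 1) (by omega)]
    -- At m = -1 the entry k - 2 is the last one of row n and need not vanish, but its factor m + 1
    -- does.
    rcases eq_or_lt_of_le (show 3 * ((n + 1 : ℕ) : ℤ) + 1 ≤ 2 * k by omega) with h1 | h1
    · have hm : (3 * ((n : ℝ) + 1) - 2 * k) + 1 = 0 := by
        have : 3 * ((n : ℝ) + 1) + 1 = 2 * k := by exact_mod_cast h1
        linarith
      rw [hm]
      ring
    · rw [dCoeff_of_lt σ n (k := k - 2) (by omega)]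
      ring

theorem dCoeff_last (σ : ℝ) (n k : ℕ) (hk : 2 * k = 3 * (n + 1)) :
    dCoeff σ (n + 1) k = -∑ r ∈ Finset.range k, (-1 : ℝ) ^ (k - r) * dCoeff σ (n + 1) r
          * (((2 * (k - r)).factorial : ℝ) / ((k - r).factorial : ℝ)) := by
  conv_lhs => simp only [dCoeff, exactRow]
  rw [if_pos (by exact_mod_cast hk)]
  congr 1
  refine Finset.sum_congr rfl fun r hr => ?_
  have hr' := Finset.mem_range.mp hr
  have hne : ¬ 2 * (r : ℤ) = 3 * ((n + 1 : ℕ) : ℤ) := by push_cast; omega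
  conv_rhs => simp only [dCoeff, exactRow]
  rw [if_neg hne]
  simp only [Int.toNat_natCast]
  rw [Nat.mul_sub]

theorem sum_abs_mul_factorial_le {k : ℕ} {Y : ℝ} {v : ℤ → ℝ} (hY : 0 ≤ Y)
    (h : ∀ r : ℕ, r < k → |v r| ≤ Y * wt (2 * ((k : ℤ) - r))) :
    ∑ r ∈ Finset.range k, |v r| * (((2 * (k - r)).factorial : ℝ) / ((k - r).factorial : ℝ))
      ≤ 16 / 9 * (Y * wt 0) := by
  calc _ ≤ ∑ r ∈ Finset.range k, (16 / 25 : ℝ) ^ (k - r) * (Y * wt 0) := by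
        refine Finset.sum_le_sum fun r hr => ?_
        have hr' := Finset.mem_range.mp hr
        have h1 := h r hr'
        have h2 := factorial_ratio_mul_wt (k - r)
        rw [show (((k - r : ℕ) : ℤ)) = (k : ℤ) - r by omega] at h2
        calc _ ≤ Y * wt (2 * ((k : ℤ) - r))
              * (((2 * (k - r)).factorial : ℝ) / ((k - r).factorial : ℝ)) := by gcongr
          _ = Y * (((2 * (k - r)).factorial : ℝ) / ((k - r).factorial : ℝ)
              * wt (2 * ((k : ℤ) - r))) := by ring
          _ = _ := by rw [h2]; ring
    _ = (∑ r ∈ Finset.range k, (16 / 25 : ℝ) ^ (k - r)) * (Y * wt 0) := by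
        rw [Finset.sum_mul]
    _ ≤ _ := by
        have := wt_nonneg 0
        exact mul_le_mul_of_nonneg_right (sum_pow_le k) (by positivity)

/-! ### The shift `σ ↦ σ - 1` -/

/-- The row before row `n`, which is `0` for `n = 0`. -/
def dPrev (σ : ℝ) : ℕ → ℤ → ℝ
  | 0 => fun _ => 0
  | n + 1 => dCoeff σ n

theorem dPrev_recurrence (σ : ℝ) (n : ℕ) (k : ℤ) :
    (3 * (n : ℝ) - 2 * k) * dCoeff σ n k = 1 / 4 * dPrev σ n k
      + (1 / 2 - σ) * dPrev σ n (k - 1)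
      - (3 * (n : ℝ) - 2 * k) * (3 * (n : ℝ) - 2 * k + 1) * dPrev σ n (k - 2) := by
  cases n with
  | zero =>
    by_cases h : k = 0 <;> simp [dPrev, dCoeff, h]
  | succ n =>
    have := dCoeff_recurrence σ n k
    push_cast
    exact this

/-- Since (2j+2)!/(j+1)! = 2(2j+1) (2j)!/j!, each term is a difference of consecutive values of the
right side. This carries the shift identity over to the entries with m = 0, which are defined by a
sum. -/
theorem telescope_factorial (G : ℤ → ℝ) (k : ℕ) (hG : G (-2) = 0) (i : ℕ) (hi : i ≤ k + 1) :
    ∑ r ∈ Finset.range i, (-1 : ℝ) ^ (k - r)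
        * (G ((r : ℤ) - 1) + 2 * (2 * ((k : ℝ) - r) + 1) * G ((r : ℤ) - 2))
        * (((2 * (k - r)).factorial : ℝ) / ((k - r).factorial : ℝ))
      = (-1 : ℝ) ^ (k + 1 - i) * G ((i : ℤ) - 2)
        * (((2 * (k + 1 - i)).factorial : ℝ) / ((k + 1 - i).factorial : ℝ)) := by
  induction i with
  | zero => simp [hG]
  | succ i ih =>
    rw [Finset.sum_range_succ, ih (by omega)]
    obtain ⟨j, rfl⟩ := Nat.exists_eq_add_of_le (show i ≤ k by omega)
    rw [show i + j + 1 - i = j + 1 by omega, show i + j - i = j by omega,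
      show i + j + 1 - (i + 1) = j by omega, show 2 * (j + 1) = 2 * j + 1 + 1 by ring,
      Nat.factorial_succ, Nat.factorial_succ, Nat.factorial_succ]
    have hj : ((j.factorial : ℕ) : ℝ) ≠ 0 := by positivity
    have hj1 : (j : ℝ) + 1 ≠ 0 := by positivity
    rw [show (((i + 1 : ℕ) : ℤ) - 2) = (i : ℤ) - 1 by push_cast; ring]
    push_cast
    field_simp
    ring

theorem dCoeff_sub_one (σ : ℝ) (n : ℕ) (k : ℤ) :
    dCoeff (σ - 1) n k = dCoeff σ n k + dPrev σ n (k - 1)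
      + 2 * (3 * (n : ℝ) - 2 * k + 1) * dPrev σ n (k - 2) := by
  induction n generalizing k with
  | zero => simp [dCoeff, dPrev]
  | succ n ih =>
    -- For m ≠ 0, multiply by m, expand row n + 1 for both parameters, replace the entries for σ - 1
    -- in row n by the induction hypothesis, and use the recurrence of row n itself at k - 1 and k -
    -- 2.
    have key : ∀ k : ℤ, 2 * k ≠ 3 * ((n + 1 : ℕ) : ℤ) →
        dCoeff (σ - 1) (n + 1) k = dCoeff σ (n + 1) k + dCoeff σ n (k - 1)
          + 2 * (3 * ((n + 1 : ℕ) : ℝ) - 2 * k + 1) * dCoeff σ n (k - 2) := by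
      intro k hk
      have hm : (3 * ((n : ℝ) + 1) - 2 * k) ≠ 0 := by
        have : (2 * k : ℝ) ≠ 3 * ((n : ℝ) + 1) := by exact_mod_cast hk
        intro h
        exact this (by linarith)
      apply mul_left_cancel₀ hm
      have r1 := dCoeff_recurrence (σ - 1) n k
      have r2 := dCoeff_recurrence σ n k
      have r3 := dPrev_recurrence σ n (k - 1)
      have r4 := dPrev_recurrence σ n (k - 2)
      have i1 := ih k
      have i2 := ih (k - 1)
      have i3 := ih (k - 2)
      rw [show k - 1 - 1 = k - 2 by ring, show k - 1 - 2 = k - 3 by ring] at r3 i2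
      rw [show k - 2 - 1 = k - 3 by ring, show k - 2 - 2 = k - 4 by ring] at r4 i3
      rw [i1, i2, i3] at r1
      push_cast at *
      linear_combination r1 - r2 - r3 - 2 * (3 * ((n : ℝ) + 1) - 2 * k) * r4
    by_cases hk : 2 * k ≠ 3 * ((n + 1 : ℕ) : ℤ)
    · exact key k hk
    · push Not at hk
      obtain ⟨K, rfl⟩ := Int.eq_ofNat_of_zero_le (show 0 ≤ k by omega)
      have hK : 2 * K = 3 * (n + 1) := by exact_mod_cast hk
      have l1 := dCoeff_last (σ - 1) n K hK
      have l2 := dCoeff_last σ n K hK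
      have t := telescope_factorial (dCoeff σ n) K (dCoeff_of_neg σ n (by norm_num)) (K + 1) le_rfl
      rw [Finset.sum_range_succ] at t
      have hKr : (2 * K : ℝ) = 3 * ((n : ℝ) + 1) := by exact_mod_cast hK
      -- The telescoped sum through r = K equals this entry, which lies beyond the end of row n
      -- because 2(K-1) = 3n + 1.
      have z : dCoeff σ n (((K + 1 : ℕ) : ℤ) - 2) = 0 :=
        dCoeff_of_lt σ n (by push_cast at hk ⊢; omega)
      rw [z] at t
      have s : ∑ r ∈ Finset.range K, (-1 : ℝ) ^ (K - r) * dCoeff (σ - 1) (n + 1) r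
          * (((2 * (K - r)).factorial : ℝ) / ((K - r).factorial : ℝ))
          = ∑ r ∈ Finset.range K, (-1 : ℝ) ^ (K - r) * dCoeff σ (n + 1) r
          * (((2 * (K - r)).factorial : ℝ) / ((K - r).factorial : ℝ))
          + ∑ r ∈ Finset.range K, (-1 : ℝ) ^ (K - r)
            * (dCoeff σ n ((r : ℤ) - 1) + 2 * (2 * ((K : ℝ) - r) + 1) * dCoeff σ n ((r : ℤ) - 2))
            * (((2 * (K - r)).factorial : ℝ) / ((K - r).factorial : ℝ)) := by
        rw [← Finset.sum_add_distrib]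
        refine Finset.sum_congr rfl fun r hr => ?_
        have hr' := Finset.mem_range.mp hr
        rw [key r (by omega)]
        push_cast
        rw [← hKr]
        ring
      simp only [dPrev]
      rw [s] at l1
      simp at t
      rw [l1, l2]
      push_cast
      rw [← hKr]
      linear_combination -t

/-! ### The bound for the coefficients -/

theorem sqrt_three_halves_le (n : ℕ) :
    √(3 * ((n : ℝ) + 1) / 2) ≤ 122475 / 100000 * √((n : ℝ) + 1) := by
  rw [show 3 * ((n : ℝ) + 1) / 2 = 3 / 2 * ((n : ℝ) + 1) by ring, Real.sqrt_mul (by norm_num)]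
  have : √(3 / 2 : ℝ) ≤ 122475 / 100000 := Real.sqrt_le_iff.mpr ⟨by norm_num, by norm_num⟩
  gcongr

/-- The size of row `n`, up to the weights. -/
def rowSize (K : ℝ) (n : ℕ) : ℝ := K ^ n * √(n.factorial : ℝ)

theorem rowSize_succ (K : ℝ) (n : ℕ) :
    rowSize K (n + 1) = K * √((n : ℝ) + 1) * rowSize K n := by
  rw [rowSize, rowSize, Nat.factorial_succ]
  push_cast
  rw [Real.sqrt_mul (by positivity)]
  ring

theorem rowSize_nonneg {K : ℝ} (hK : 0 ≤ K) (n : ℕ) : 0 ≤ rowSize K n := by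
  rw [rowSize]
  positivity

theorem abs_dCoeff_zero_le (σ K : ℝ) (k : ℤ) :
    |dCoeff σ 0 k| ≤ rowSize K 0 * wtHat (3 * ((0 : ℕ) : ℤ) - 2 * k) := by
  by_cases hk : k = 0
  · subst hk
    -- The initial value 1 exceeds w(0) = 1/√π; the doubled weight covers it.
    have h : √Real.pi ≤ 2 := Real.sqrt_le_iff.mpr ⟨by norm_num, by linarith [Real.pi_le_four]⟩
    simp only [dCoeff, rowSize, if_true]
    norm_num [wtHat_zero, wt_zero]
    rw [← div_eq_mul_inv, le_div_iff₀ (by positivity)]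
    linarith
  · simp [dCoeff, hk, rowSize, wtHat_nonneg]

theorem abs_dCoeff_one_le {σ K : ℝ} (hσ : |1 / 2 - σ| ≤ 3 / 2) (hK : 5 ≤ K) {k : ℤ}
    (hk0 : 0 ≤ k) (hk : 2 * k < 3) :
    |dCoeff σ 1 k| ≤ rowSize K 1 * wtHat (3 - 2 * k) := by
  have h := dCoeff_succ_of_lt σ 0 hk0 (by simpa using hk)
  have hr : rowSize K 1 = K := by simp [rowSize]
  rw [hr]
  rcases (show k = 0 ∨ k = 1 by omega) with rfl | rfl
  · have h3 := wt_add_two (i := 1) (by norm_num)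
    norm_num [wt_one] at h3
    norm_num [dCoeff] at h ⊢
    rw [h, wtHat_of_ne (by norm_num), show wt 3 = 8 / 125 by linarith]
    norm_num
    linarith
  · norm_num [dCoeff] at h ⊢
    rw [h, wtHat_of_ne (by norm_num), wt_one]
    norm_num at hσ
    linarith

/-- The middle term has no factor √(n+1) and is absorbed through √(n+1) ≥ 1.414. This fails for n =
0, so row 1 is computed explicitly. -/
theorem abs_dCoeff_succ_le {σ K : ℝ} (hσ : |1 / 2 - σ| ≤ 3 / 2) (hK : 502 / 100 ≤ K) (n : ℕ)
    (hn : n ≠ 0) (ih : ∀ k, |dCoeff σ n k| ≤ rowSize K n * wtHat (3 * n - 2 * k)) {k : ℤ}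
    (hk0 : 0 ≤ k) (hk : 2 * k < 3 * ((n + 1 : ℕ) : ℤ)) :
    |dCoeff σ (n + 1) k| ≤ rowSize K (n + 1) * wt (3 * ((n + 1 : ℕ) : ℤ) - 2 * k) := by
  have hX := rowSize_nonneg (K := K) (by linarith) n
  have t1 := abs_first_term_le hX ih hk0 hk
  have t2 := abs_second_term_le hX ih hk
  have t3 := abs_third_term_le hX ih (fun k hk => dCoeff_of_neg σ n hk) hk.le
  have hS := sqrt_three_halves_le n
  have hs : 1414 / 1000 ≤ √((n : ℝ) + 1) := by
    have : (1 : ℝ) ≤ n := by exact_mod_cast Nat.one_le_iff_ne_zero.mpr hn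
    exact Real.le_sqrt_of_sq_le (by nlinarith)
  have hm : 0 < 3 * ((n : ℝ) + 1) - 2 * k := by
    have : (2 * k : ℝ) < 3 * ((n : ℝ) + 1) := by exact_mod_cast hk
    linarith
  have hY : 0 ≤ rowSize K n * wt (3 * ((n + 1 : ℕ) : ℤ) - 2 * k) := mul_nonneg hX (wt_nonneg _)
  rw [rowSize_succ]
  generalize hYd : rowSize K n * wt (3 * ((n + 1 : ℕ) : ℤ) - 2 * k) = Y at *
  have hd : |dCoeff σ (n + 1) k| ≤ |dCoeff σ n k| / (4 * (3 * ((n : ℝ) + 1) - 2 * k))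
      + 3 / 2 * (|dCoeff σ n (k - 1)| / (3 * ((n : ℝ) + 1) - 2 * k))
      + (3 * ((n : ℝ) + 1) - 2 * k + 1) * |dCoeff σ n (k - 2)| := by
    rw [dCoeff_succ_of_lt σ n hk0 hk]
    refine (abs_sub _ _).trans (add_le_add ((abs_add_le _ _).trans (add_le_add ?_ ?_)) ?_)
    · rw [abs_div, abs_of_pos (show 0 < 4 * (3 * ((n : ℝ) + 1) - 2 * k) by linarith)]
    · rw [abs_mul, abs_div, abs_of_pos hm]
      gcongr
    · rw [abs_mul, abs_of_pos (by linarith)]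
  have hYS : √(3 * ((n : ℝ) + 1) / 2) * Y ≤ 122475 / 100000 * √((n : ℝ) + 1) * Y := by gcongr
  have hYs : 1414 / 1000 * Y ≤ √((n : ℝ) + 1) * Y := by gcongr
  have hYK : 502 / 100 * (√((n : ℝ) + 1) * Y) ≤ K * (√((n : ℝ) + 1) * Y) := by gcongr
  rw [show K * √((n : ℝ) + 1) * rowSize K n * wt (3 * ((n + 1 : ℕ) : ℤ) - 2 * k)
    = K * (√((n : ℝ) + 1) * Y) by rw [← hYd]; ring]
  -- At m = 1 the middle constant is 2.83 but the first term is absent; for m ≥ 2 all three terms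
  -- occur with middle constant 5/4.
  rcases eq_or_lt_of_le (show 2 * k + 1 ≤ 3 * ((n + 1 : ℕ) : ℤ) by omega) with h1 | h1
  · rw [dCoeff_of_lt σ n (k := k) (by omega)] at hd
    rw [abs_zero, zero_div] at hd
    rw [← div_le_iff₀ hm] at t2
    nlinarith
  · have t2' := abs_second_term_le_of_two_le hX ih (k := k) (by omega)
    rw [hYd] at t2'
    rw [← div_le_iff₀ hm] at t2'
    rw [← div_le_iff₀ (by linarith)] at t1
    nlinarith

theorem abs_dCoeff_le_base {σ K : ℝ} (hσ : |1 / 2 - σ| ≤ 3 / 2) (hK : 502 / 100 ≤ K) (n : ℕ)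
    (k : ℤ) : |dCoeff σ n k| ≤ rowSize K n * wtHat (3 * n - 2 * k) := by
  have hR := fun n => rowSize_nonneg (K := K) (by linarith) n
  induction n generalizing k with
  | zero => exact abs_dCoeff_zero_le σ K k
  | succ n ih =>
    rcases lt_or_ge k 0 with hk0 | hk0
    · rw [dCoeff_of_neg σ _ hk0, abs_zero]
      exact mul_nonneg (hR _) (wtHat_nonneg _)
    rcases lt_trichotomy (2 * k) (3 * ((n + 1 : ℕ) : ℤ)) with hk | hk | hk
    · by_cases hn : n = 0
      · subst hn
        simpa using abs_dCoeff_one_le hσ (by linarith) hk0 (by simpa using hk)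
      · exact (abs_dCoeff_succ_le hσ hK n hn ih hk0 hk).trans
          (mul_le_mul_of_nonneg_left (wt_le_wtHat _) (hR _))
    · have hn : n ≠ 0 := by rintro rfl; simp at hk; omega
      obtain ⟨j, rfl⟩ := Int.eq_ofNat_of_zero_le hk0
      have hj : 2 * j = 3 * (n + 1) := by exact_mod_cast hk
      rw [dCoeff_last σ n j hj, abs_neg, show 3 * ((n + 1 : ℕ) : ℤ) - 2 * (j : ℤ) = 0 by omega,
        wtHat_zero]
      have hsum := sum_abs_mul_factorial_le (k := j) (v := dCoeff σ (n + 1)) (hR (n + 1))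
        (fun r hr => by
          have := abs_dCoeff_succ_le hσ hK n hn ih (k := r) (by positivity) (by omega)
          rwa [← hk, ← mul_sub] at this)
      refine (Finset.abs_sum_le_sum_abs _ _).trans (le_trans (le_of_eq ?_) (hsum.trans ?_))
      · refine Finset.sum_congr rfl fun r _ => ?_
        rw [abs_mul, abs_mul, abs_pow, abs_neg, abs_one, one_pow, one_mul,
          abs_of_nonneg (a := ((2 * (j - r)).factorial : ℝ) / _) (by positivity)]
      · nlinarith [mul_nonneg (hR (n + 1)) (wt_nonneg 0)]
    · rw [dCoeff_of_lt σ _ hk, abs_zero]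
      exact mul_nonneg (hR _) (wtHat_nonneg _)

/-! ### Transport of the bound from σ to σ ± 1 -/

theorem abs_shift_term_le {n : ℕ} {k : ℤ} {X : ℝ} {prev : ℤ → ℝ} (hX : 0 ≤ X)
    (h : ∀ k, |prev k| ≤ X * wtHat (3 * n - 2 * k))
    (h0 : ∀ k < 0, prev k = 0) (hk : 2 * k ≤ 3 * ((n + 1 : ℕ) : ℤ)) :
    |prev (k - 1) + 2 * (3 * ((n : ℝ) + 1) - 2 * k + 1) * prev (k - 2)|
      ≤ 50215 / 10000 * √((n : ℝ) + 1) * (X * wtHat (3 * ((n + 1 : ℕ) : ℤ) - 2 * k)) := by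
  have t3 := abs_third_term_le hX h h0 hk
  have hS := sqrt_three_halves_le n
  have hS1 : 122 / 100 ≤ √(3 * ((n : ℝ) + 1) / 2) :=
    Real.le_sqrt_of_sq_le (by have : (0 : ℝ) ≤ n := by positivity
                              linarith)
  have hm : 0 ≤ 3 * ((n : ℝ) + 1) - 2 * k := by
    have : (2 * k : ℝ) ≤ 3 * ((n : ℝ) + 1) := by exact_mod_cast hk
    linarith
  have hY : 0 ≤ X * wt (3 * ((n + 1 : ℕ) : ℤ) - 2 * k) := mul_nonneg hX (wt_nonneg _)
  have hYY : X * wt (3 * ((n + 1 : ℕ) : ℤ) - 2 * k) ≤ X * wtHat (3 * ((n + 1 : ℕ) : ℤ) - 2 * k) :=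
    mul_le_mul_of_nonneg_left (wt_le_wtHat _) hX
  have t2 : |prev (k - 1)|
      ≤ 5 / 2 * √(3 * ((n : ℝ) + 1) / 2) * (X * wt (3 * ((n + 1 : ℕ) : ℤ) - 2 * k)) := by
    rcases lt_or_ge (k - 1) 0 with hk1 | hk1
    · rw [h0 _ hk1, abs_zero]
      positivity
    have h3 := h (k - 1)
    have hk1' : (1 : ℝ) ≤ k := by exact_mod_cast (by omega : 1 ≤ k)
    rw [show (3 * (n : ℤ) - 2 * (k - 1)) = 3 * ((n + 1 : ℕ) : ℤ) - 2 * k - 1 by push_cast; ring]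
      at h3
    rcases lt_trichotomy (2 * k + 1) (3 * ((n + 1 : ℕ) : ℤ)) with h1 | h1 | h1
    · have h4 := wt_le_succ (i := 3 * ((n + 1 : ℕ) : ℤ) - 2 * k - 1) (by omega)
      have h5 : √((((3 * ((n + 1 : ℕ) : ℤ) - 2 * k - 1 : ℤ) : ℝ) + 1) / 2)
          ≤ √(3 * ((n : ℝ) + 1) / 2) := Real.sqrt_le_sqrt (by push_cast; linarith)
      rw [sub_add_cancel] at h4
      rw [wtHat_of_ne (by omega)] at h3
      have hw := wt_nonneg (3 * ((n + 1 : ℕ) : ℤ) - 2 * k)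
      calc _ ≤ _ := h3
        _ ≤ X * (5 / 2 * √(3 * ((n : ℝ) + 1) / 2) * wt (3 * ((n + 1 : ℕ) : ℤ) - 2 * k)) := by
          refine mul_le_mul_of_nonneg_left (h4.trans ?_) hX
          gcongr
        _ = _ := by ring
    · have t2 := abs_second_term_le hX h (k := k) (by omega)
      have hm1 : 3 * ((n : ℝ) + 1) - 2 * k = 1 := by
        have : (2 * k + 1 : ℝ) = 3 * ((n : ℝ) + 1) := by exact_mod_cast h1
        linarith
      rw [hm1] at t2
      nlinarith
    · rw [wtHat_of_neg (by omega), mul_zero] at h3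
      exact h3.trans (by positivity)
  calc _ ≤ |prev (k - 1)| + 2 * ((3 * ((n : ℝ) + 1) - 2 * k + 1) * |prev (k - 2)|) := by
        refine (abs_add_le _ _).trans (le_of_eq ?_)
        rw [abs_mul, abs_mul, abs_of_nonneg (a := 3 * ((n : ℝ) + 1) - 2 * k + 1) (by linarith),
          abs_two]
        ring
    -- 41/10 = 5/2 + 2 · 4/5, and 41/10 · √(3/2) < 5.0215.
    _ ≤ 41 / 10 * (√(3 * ((n : ℝ) + 1) / 2) * (X * wt (3 * ((n + 1 : ℕ) : ℤ) - 2 * k))) := by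
        linarith
    _ ≤ 41 / 10 * (122475 / 100000 * √((n : ℝ) + 1)
        * (X * wtHat (3 * ((n + 1 : ℕ) : ℤ) - 2 * k))) := by gcongr
    _ ≤ _ := by
        have := mul_nonneg (Real.sqrt_nonneg ((n : ℝ) + 1)) (hY.trans hYY)
        linarith

/-- `CoeffBound A K σ` says that the coefficients for `σ` are bounded by `A * rowSize K n`, up to
the weights. -/
def CoeffBound (A K σ : ℝ) : Prop :=
  ∀ (n : ℕ) (k : ℤ), |dCoeff σ n k| ≤ A * (rowSize K n * wtHat (3 * n - 2 * k))

theorem CoeffBound.mono {A A' K σ : ℝ} (hA : A ≤ A') (hK : 0 ≤ K) (h : CoeffBound A K σ) :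
    CoeffBound A' K σ := fun n k =>
  (h n k).trans (mul_le_mul_of_nonneg_right hA
    (mul_nonneg (rowSize_nonneg hK n) (wtHat_nonneg _)))

theorem abs_shift_term_le_of_bound {A K σ ρ : ℝ} (hA : 0 ≤ A) (hK : 0 ≤ K)
    (hρ : 50215 / 10000 ≤ ρ * K) {n : ℕ} {k : ℤ}
    (h : ∀ k, |dCoeff σ n k| ≤ A * (rowSize K n * wtHat (3 * n - 2 * k)))
    (hk : 2 * k ≤ 3 * ((n + 1 : ℕ) : ℤ)) :
    |dCoeff σ n (k - 1) + 2 * (3 * ((n : ℝ) + 1) - 2 * k + 1) * dCoeff σ n (k - 2)|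
      ≤ ρ * A * (rowSize K (n + 1) * wtHat (3 * ((n + 1 : ℕ) : ℤ) - 2 * k)) := by
  have hR := rowSize_nonneg hK n
  have hW := wtHat_nonneg (3 * ((n + 1 : ℕ) : ℤ) - 2 * k)
  have h1 := abs_shift_term_le (X := A * rowSize K n) (mul_nonneg hA hR)
    (fun k => (h k).trans (le_of_eq (by ring))) (fun k hk => dCoeff_of_neg σ n hk) hk
  refine h1.trans ?_
  rw [rowSize_succ]
  have hP : 0 ≤ √((n : ℝ) + 1) * (A * rowSize K n * wtHat (3 * ((n + 1 : ℕ) : ℤ) - 2 * k)) := by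
    positivity
  calc _ = 50215 / 10000
        * (√((n : ℝ) + 1) * (A * rowSize K n * wtHat (3 * ((n + 1 : ℕ) : ℤ) - 2 * k))) := by ring
    _ ≤ ρ * K
        * (√((n : ℝ) + 1) * (A * rowSize K n * wtHat (3 * ((n + 1 : ℕ) : ℤ) - 2 * k))) := by gcongr
    _ = _ := by ring

theorem CoeffBound.sub_one {A K σ : ℝ} (hA : 0 ≤ A) (hK : 50215 / 10000 ≤ K)
    (h : CoeffBound A K σ) : CoeffBound (2 * A) K (σ - 1) := by
  intro n k
  have hK0 : 0 ≤ K := by linarith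
  have hP := mul_nonneg hA (mul_nonneg (rowSize_nonneg hK0 n) (wtHat_nonneg (3 * n - 2 * k)))
  have h0 := h n k
  rw [dCoeff_sub_one]
  cases n with
  | zero =>
    simp only [dPrev, mul_zero, add_zero]
    linarith
  | succ n =>
    rcases lt_or_ge (3 * ((n + 1 : ℕ) : ℤ)) (2 * k) with hk | hk
    · rw [← dCoeff_sub_one, dCoeff_of_lt _ _ hk, abs_zero]
      linarith
    · have h1 := abs_shift_term_le_of_bound (ρ := 1) hA hK0 (by linarith) (h n) hk
      rw [add_assoc]
      refine (abs_add_le _ _).trans ?_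
      simp only [dPrev]
      push_cast at *
      linarith

/-- Read upwards, the shift identity has the preceding row for σ itself on the right, so an
induction on n is needed. The factor 9 solves 1 + (8/9) · 9 = 9. -/
theorem CoeffBound.of_sub_one {A K σ : ℝ} (hA : 0 ≤ A) (hK : 50215 / 10000 ≤ 8 / 9 * K)
    (h : CoeffBound A K (σ - 1)) : CoeffBound (9 * A) K σ := by
  intro n
  have hK0 : 0 ≤ K := by linarith
  induction n with
  | zero =>
    intro k
    have hP := mul_nonneg hA
      (mul_nonneg (rowSize_nonneg hK0 0) (wtHat_nonneg (3 * (0 : ℕ) - 2 * k)))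
    have h0 := h 0 k
    simp only [dCoeff] at *
    linarith
  | succ n ih =>
    intro k
    have hP := mul_nonneg hA
      (mul_nonneg (rowSize_nonneg hK0 (n + 1)) (wtHat_nonneg (3 * (n + 1 : ℕ) - 2 * k)))
    rcases lt_or_ge (3 * ((n + 1 : ℕ) : ℤ)) (2 * k) with hk | hk
    · rw [dCoeff_of_lt _ _ hk, abs_zero]
      linarith
    · have h1 := abs_shift_term_le_of_bound (ρ := 8 / 9) (by positivity) hK0 hK ih hk
      have h0 := h (n + 1) k
      have h2 := dCoeff_sub_one σ (n + 1) k
      simp only [dPrev] at h2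
      push_cast at *
      have h3 : dCoeff σ (n + 1) k = dCoeff (σ - 1) (n + 1) k
          - (dCoeff σ n (k - 1) + 2 * (3 * ((n : ℝ) + 1) - 2 * k + 1) * dCoeff σ n (k - 2)) := by
        rw [h2]; ring
      rw [h3]
      refine (abs_sub _ _).trans ?_
      linarith

theorem coeffBound_base {σ K : ℝ} (hσ : |1 / 2 - σ| ≤ 3 / 2) (hK : 502 / 100 ≤ K) :
    CoeffBound 1 K σ := fun n k => by
  rw [one_mul]
  exact abs_dCoeff_le_base hσ hK n k

theorem coeffBound_of_pos {σ K : ℝ} (hσ : 0 < σ) (hK : 50215 / 10000 ≤ 8 / 9 * K) :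
    CoeffBound (9 ^ σ) K σ := by
  obtain ⟨N, hN⟩ := exists_nat_ge σ
  induction N generalizing σ with
  | zero => simp at hN; linarith
  | succ N ih =>
    rcases le_or_gt σ 1 with h1 | h1
    · refine (coeffBound_base (abs_le.mpr ⟨by linarith, by linarith⟩) (by linarith)).mono ?_
        (by linarith)
      exact Real.one_le_rpow (by norm_num) hσ.le
    · push_cast at hN
      have := (ih (σ := σ - 1) (by linarith) (by linarith)).of_sub_one (by positivity) hK
      rwa [show (9 : ℝ) * 9 ^ (σ - 1) = 9 ^ σ by
        rw [Real.rpow_sub_one (by norm_num)]; ring] at this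

theorem coeffBound_of_nonpos {σ K : ℝ} (hσ : σ ≤ 0) (hK : 50215 / 10000 ≤ K) :
    CoeffBound (2 ^ (-σ)) K σ := by
  obtain ⟨N, hN⟩ := exists_nat_ge (-σ)
  induction N generalizing σ with
  | zero =>
    have : σ = 0 := by simp at hN; linarith
    subst this
    refine (coeffBound_base (abs_le.mpr ⟨by linarith, by linarith⟩) (by linarith)).mono ?_
        (by linarith)
    simp
  | succ N ih =>
    rcases le_or_gt (-1) σ with h1 | h1
    · refine (coeffBound_base (abs_le.mpr ⟨by linarith, by linarith⟩) (by linarith)).mono ?_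
        (by linarith)
      exact Real.one_le_rpow (by norm_num) (by linarith)
    · push_cast at hN
      have := (ih (σ := σ + 1) (by linarith) (by linarith)).sub_one (by positivity) hK
      rwa [add_sub_cancel_right, show (2 : ℝ) * 2 ^ (-(σ + 1)) = 2 ^ (-σ) by
        rw [neg_add, ← sub_eq_add_neg, Real.rpow_sub_one (by norm_num)]; ring] at this

/-! ### Numerical checks of the growth rate -/

theorem constB₁_sq_le (σ : ℝ) : constB₁ σ ^ 2 ≤ 1228 / 1000 := by
  rw [constB₁]
  split_ifs
  · norm_num
  · rw [mul_pow, Real.sq_sqrt (by linarith [Real.log_two_lt_d9])]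
    linarith [Real.log_two_gt_d9]

theorem one_le_constB₁ (σ : ℝ) : 1 ≤ constB₁ σ := by
  rw [constB₁]
  split_ifs
  · norm_num
  · have : 1 / 2 ≤ √(1 - Real.log 2) :=
      Real.le_sqrt_of_sq_le (by linarith [Real.log_two_lt_d9])
    linarith

/-- The growth rate of the coefficients. -/
def growth (σ : ℝ) : ℝ := 4 * √2 / constB₁ σ

theorem growth_ge (σ : ℝ) : 50215 / 10000 ≤ growth σ := by
  have h1 := one_le_constB₁ σ
  have h2 := constB₁_sq_le σ
  rw [growth, le_div_iff₀ (by linarith)]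
  have h3 : 14142 / 10000 ≤ √(2 : ℝ) := Real.le_sqrt_of_sq_le (by norm_num)
  have h4 : constB₁ σ ≤ 11082 / 10000 := by nlinarith
  linarith

theorem constA_pos (σ : ℝ) : 0 < constA σ := by
  rw [constA]
  split_ifs <;> positivity

theorem coeffBound (σ : ℝ) : CoeffBound (constA σ) (growth σ) σ := by
  have h := growth_ge σ
  rcases lt_or_ge 0 σ with hσ | hσ
  · rw [constA, if_pos hσ]
    -- Here B₁ = 1 and 8K/9 = 32√2/9 > 5.028.
    refine coeffBound_of_pos hσ ?_
    rw [growth, constB₁, if_pos hσ]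
    have h3 : 14142 / 10000 ≤ √(2 : ℝ) := Real.le_sqrt_of_sq_le (by norm_num)
    linarith
  · rw [constA, if_neg (not_lt.mpr hσ)]
    exact coeffBound_of_nonpos hσ h

/-! ### Rounding errors -/

theorem isRepresentable_zero : IsRepresentable 0 := ⟨0, 0, by simp⟩

theorem isRepresentable_one : IsRepresentable 1 := ⟨1, 0, by simp⟩

theorem isRepresentable_rnd (d : ℕ) (x : ℝ) : IsRepresentable (rnd d x) := by
  rw [rnd]
  split_ifs
  · exact isRepresentable_zero
  · exact ⟨_, _, rfl⟩

theorem abs_roundEven_sub_le (y : ℝ) : |(roundEven y : ℝ) - y| ≤ 1 / 2 := by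
  have h := Int.floor_add_fract y
  have h0 := Int.fract_nonneg y
  have h1 := Int.fract_lt_one y
  rw [roundEven]
  split_ifs <;> rw [abs_le] <;> push_cast <;> constructor <;> linarith

/-- Half a unit in the last place is 2^(-d) times the largest power of 2 not exceeding |x|. -/
theorem abs_rnd_sub_le (d : ℕ) (x : ℝ) : |rnd d x - x| ≤ |x| * (1 / 2 ^ d) := by
  rw [rnd]
  split_ifs with hx
  · simp [hx]
  · have hx' : 0 < |x| := abs_pos.mpr hx
    have hlog : (2 : ℝ) ^ Int.log 2 |x| ≤ |x| := by
      exact_mod_cast Int.zpow_log_le_self (b := 2) (by norm_num) hx'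
    set e : ℤ := Int.log 2 |x| + 1 - (d : ℤ) with he
    have hp : (0 : ℝ) < 2 ^ e := by positivity
    have h1 := abs_roundEven_sub_le (x / 2 ^ e)
    have h2 : (roundEven (x / 2 ^ e) : ℝ) * 2 ^ e - x
        = ((roundEven (x / 2 ^ e) : ℝ) - x / 2 ^ e) * 2 ^ e := by
      rw [sub_mul, div_mul_cancel₀ _ hp.ne']
    simp only
    rw [h2, abs_mul, abs_of_pos hp]
    have h3 : (2 : ℝ) ^ e = 2 ^ Int.log 2 |x| * 2 * (1 / 2 ^ d) := by
      rw [he, zpow_sub₀ (by norm_num), zpow_add₀ (by norm_num)]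
      simp [div_eq_mul_inv]
    calc _ ≤ 1 / 2 * (2 : ℝ) ^ e := by gcongr
      _ = 2 ^ Int.log 2 |x| * (1 / 2 ^ d) := by rw [h3]; ring
      _ ≤ _ := by gcongr

/-- `t` is a factor that can result from `p` relative errors of size at most `u`. -/
def ErrFactor (u : ℝ) (p : ℕ) (t : ℝ) : Prop := (1 - u) ^ p ≤ t ∧ t * (1 - u) ^ p ≤ 1

namespace ErrFactor

variable {u s t : ℝ} {p q : ℕ}

theorem one (u : ℝ) : ErrFactor u 0 1 := by simp [ErrFactor]

theorem pos (hu : u < 1) (h : ErrFactor u p t) : 0 < t :=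
  lt_of_lt_of_le (pow_pos (by linarith) p) h.1

theorem mono (hu0 : 0 ≤ u) (hu : u < 1) (hpq : p ≤ q) (h : ErrFactor u p t) :
    ErrFactor u q t := by
  have h1 : (1 - u) ^ q ≤ (1 - u) ^ p := pow_le_pow_of_le_one (by linarith) (by linarith) hpq
  exact ⟨h1.trans h.1, (mul_le_mul_of_nonneg_left h1 (h.pos hu).le).trans h.2⟩

theorem mono_left {u' : ℝ} (hu : u ≤ u') (hu1 : u' < 1) (h : ErrFactor u p t) :
    ErrFactor u' p t := by
  have h1 : (1 - u') ^ p ≤ (1 - u) ^ p := pow_le_pow_left₀ (by linarith) (by linarith) p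
  exact ⟨h1.trans h.1, (mul_le_mul_of_nonneg_left h1 (h.pos (by linarith)).le).trans h.2⟩

theorem mul (hu : u < 1) (hs : ErrFactor u p s) (ht : ErrFactor u q t) :
    ErrFactor u (p + q) (s * t) := by
  have hv : 0 < 1 - u := by linarith
  have hs0 := hs.pos hu
  have ht0 := ht.pos hu
  refine ⟨?_, ?_⟩
  · rw [pow_add]
    exact mul_le_mul hs.1 ht.1 (by positivity) hs0.le
  · calc s * t * (1 - u) ^ (p + q) = (s * (1 - u) ^ p) * (t * (1 - u) ^ q) := by
          rw [pow_add]; ring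
      _ ≤ 1 * 1 := mul_le_mul hs.2 ht.2 (by positivity) zero_le_one
      _ = 1 := one_mul 1

theorem inv (hu : u < 1) (ht : ErrFactor u p t) : ErrFactor u p t⁻¹ := by
  have ht0 := ht.pos hu
  refine ⟨?_, ?_⟩
  · rw [le_inv_comm₀ (pow_pos (by linarith) p) ht0, ← one_div, le_div_iff₀ (pow_pos (by linarith) p)]
    exact ht.2
  · rw [inv_mul_le_iff₀ ht0, mul_one]
    exact ht.1

theorem of_abs_le (hu0 : 0 ≤ u) (hu : u < 1) (h : |t - 1| ≤ u) : ErrFactor u 1 t := by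
  rw [abs_le] at h
  refine ⟨by rw [pow_one]; linarith, ?_⟩
  rw [pow_one]
  nlinarith

theorem abs_sub_one_le (hu0 : 0 ≤ u) (hp : p * u < 1) (h : ErrFactor u p t) (hu : u < 1) :
    |t - 1| ≤ p * u / (1 - p * u) := by
  have hb : 1 - p * u ≤ (1 - u) ^ p := by
    have := one_add_mul_le_pow (a := -u) (by linarith) p
    rw [← sub_eq_add_neg] at this
    linarith
  have ht := h.pos hu
  have h2 : t * (1 - p * u) ≤ 1 := (mul_le_mul_of_nonneg_left hb ht.le).trans h.2
  have hq : 0 < 1 - p * u := by linarith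
  have hpu : 0 ≤ p * u := by positivity
  rw [le_div_iff₀ hq]
  have h1 := hb.trans h.1
  rcases abs_cases (t - 1) with ⟨e, _⟩ | ⟨e, _⟩ <;> rw [e] <;> nlinarith

end ErrFactor

/-- `y` results from `x` by `p` relative errors of size at most `u`. -/
def RelApprox (u : ℝ) (p : ℕ) (y x : ℝ) : Prop := ∃ t, ErrFactor u p t ∧ y = x * t

/-! ### Error factors of the operations and of the two inner loops -/

section Ops

variable {d : ℕ}

theorem unit_pos (d : ℕ) : (0 : ℝ) < 1 / 2 ^ d := by positivity

theorem unit_lt_one (hd : 1 ≤ d) : (1 / 2 ^ d : ℝ) < 1 := by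
  rw [div_lt_one (by positivity)]
  exact one_lt_pow₀ (by norm_num) (by omega)

theorem RelApprox.refl (u x : ℝ) : RelApprox u 0 x x := ⟨1, ErrFactor.one u, by ring⟩

theorem RelApprox.of_abs_sub_le {u x y : ℝ} (hu0 : 0 ≤ u) (hu : u < 1) (h : |y - x| ≤ |x| * u) :
    RelApprox u 1 y x := by
  by_cases hx : x = 0
  · subst hx
    simp at h
    exact ⟨1, (ErrFactor.one u).mono hu0 hu (by omega), by rw [h]; ring⟩
  · refine ⟨y / x, ErrFactor.of_abs_le hu0 hu ?_, by field_simp⟩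
    have : y / x - 1 = (y - x) / x := by field_simp
    rw [this, abs_div, div_le_iff₀ (abs_pos.mpr hx)]
    linarith

theorem RelApprox.rnd (hd : 1 ≤ d) {p : ℕ} {x y : ℝ} (h : RelApprox (1 / 2 ^ d) p y x) :
    RelApprox (1 / 2 ^ d) (p + 1) (rnd d y) x := by
  obtain ⟨t, ht, rfl⟩ := h
  obtain ⟨s, hs, e⟩ := RelApprox.of_abs_sub_le (unit_pos d).le (unit_lt_one hd)
    (abs_rnd_sub_le d (x * t))
  exact ⟨t * s, ht.mul (unit_lt_one hd) hs, by rw [e]; ring⟩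

theorem RelApprox.fmul (hd : 1 ≤ d) {p q : ℕ} {x y x' y' : ℝ}
    (hx : RelApprox (1 / 2 ^ d) p x' x) (hy : RelApprox (1 / 2 ^ d) q y' y) :
    RelApprox (1 / 2 ^ d) (p + q + 3) (fmul d x' y') (x * y) := by
  obtain ⟨s, hs, es⟩ := hx.rnd hd
  obtain ⟨t, ht, et⟩ := hy.rnd hd
  have h : RelApprox (1 / 2 ^ d) ((p + 1) + (q + 1)) (RiemannSiegel.rnd d x' * RiemannSiegel.rnd d y')
      (x * y) := ⟨s * t, hs.mul (unit_lt_one hd) ht, by rw [es, et]; ring⟩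
  have h' := h.rnd hd
  rwa [show p + 1 + (q + 1) + 1 = p + q + 3 by ring] at h'

theorem RelApprox.fdiv (hd : 1 ≤ d) {p q : ℕ} {x y x' y' : ℝ}
    (hx : RelApprox (1 / 2 ^ d) p x' x) (hy : RelApprox (1 / 2 ^ d) q y' y) :
    RelApprox (1 / 2 ^ d) (p + q + 3) (fdiv d x' y') (x / y) := by
  obtain ⟨s, hs, es⟩ := hx.rnd hd
  obtain ⟨t, ht, et⟩ := hy.rnd hd
  have h : RelApprox (1 / 2 ^ d) ((p + 1) + (q + 1)) (RiemannSiegel.rnd d x' / RiemannSiegel.rnd d y')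
      (x / y) := ⟨s * t⁻¹, hs.mul (unit_lt_one hd) (ht.inv (unit_lt_one hd)), by
        rw [es, et, div_eq_mul_inv, mul_inv]; ring⟩
  have h' := h.rnd hd
  rwa [show p + 1 + (q + 1) + 1 = p + q + 3 by ring] at h'

theorem exists_fadd_eq (hd : 1 ≤ d) (x y : ℝ) : ∃ s t, ErrFactor (1 / 2 ^ d) 2 s ∧
    ErrFactor (1 / 2 ^ d) 2 t ∧ fadd d x y = x * s + y * t := by
  have hu := unit_lt_one hd
  obtain ⟨s, hs, es⟩ := (RelApprox.refl (1 / 2 ^ d) x).rnd hd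
  obtain ⟨t, ht, et⟩ := (RelApprox.refl (1 / 2 ^ d) y).rnd hd
  obtain ⟨r, hr, er⟩ := (RelApprox.refl (1 / 2 ^ d) (rnd d x + rnd d y)).rnd hd
  exact ⟨s * r, t * r, hs.mul hu hr, ht.mul hu hr, by rw [fadd, er, es, et]; ring⟩

theorem exists_fsub_eq (hd : 1 ≤ d) (x y : ℝ) : ∃ s t, ErrFactor (1 / 2 ^ d) 2 s ∧
    ErrFactor (1 / 2 ^ d) 2 t ∧ fsub d x y = x * s - y * t := by
  have hu := unit_lt_one hd
  obtain ⟨s, hs, es⟩ := (RelApprox.refl (1 / 2 ^ d) x).rnd hd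
  obtain ⟨t, ht, et⟩ := (RelApprox.refl (1 / 2 ^ d) y).rnd hd
  obtain ⟨r, hr, er⟩ := (RelApprox.refl (1 / 2 ^ d) (rnd d x - rnd d y)).rnd hd
  exact ⟨s * r, t * r, hs.mul hu hr, ht.mul hu hr, by rw [fsub, er, es, et]; ring⟩

/-- Cancellation in 1 - 2σ can destroy relative accuracy, so the two parts keep separate error
factors. Errors at the higher precision d₁ are counted as errors at d. -/
theorem exists_one_sub_two_mul_eq {d₁ : ℕ} (hd : 1 ≤ d) (hd₁ : d ≤ d₁) (σ : ℝ) :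
    ∃ s t, ErrFactor (1 / 2 ^ d) 2 s ∧ ErrFactor (1 / 2 ^ d) 5 t ∧
      fsub d₁ 1 (fmul d₁ 2 σ) = s - 2 * σ * t := by
  have hu := unit_lt_one hd
  have hd₁' : 1 ≤ d₁ := hd.trans hd₁
  have huu : (1 / 2 ^ d₁ : ℝ) ≤ 1 / 2 ^ d :=
    one_div_le_one_div_of_le (by positivity) (pow_le_pow_right₀ (by norm_num) hd₁)
  obtain ⟨r, hr, er⟩ := (RelApprox.refl (1 / 2 ^ d₁) 2).fmul hd₁' (RelApprox.refl (1 / 2 ^ d₁) σ)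
  obtain ⟨s, t, hs, ht, e⟩ := exists_fsub_eq hd₁' 1 (fmul d₁ 2 σ)
  refine ⟨s, r * t, hs.mono_left huu hu, (hr.mul (unit_lt_one hd₁') ht).mono_left huu hu, ?_⟩
  rw [e, er]
  ring

/-- The longest chain has 19 rounding errors: 12 in the product `c2 * z`, 2 in the last addition, 5
in the part 2σ of `psigma`. -/
theorem abs_stepGen_sub_le {d₁ : ℕ} (hd : 1 ≤ d) (hd₁ : d ≤ d₁) (hu19 : 19 * (1 / 2 ^ d : ℝ) < 1)
    (σ : ℝ) {m : ℤ} (hm : 0 < m) (x y z : ℝ) :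
    |stepGen d (fsub d₁ 1 (fmul d₁ 2 σ)) m x y z
        - (y / (4 * m) + (1 / 2 - σ) * (z / m) - ((m : ℝ) + 1) * x)|
      ≤ 19 * (1 / 2 ^ d) / (1 - 19 * (1 / 2 ^ d))
        * (|y| / (4 * m) + (1 / 2 + |σ|) * (|z| / m) + ((m : ℝ) + 1) * |x|) := by
  have hu := unit_lt_one hd
  have hu0 := (unit_pos d).le
  have hm' : (0 : ℝ) < m := by exact_mod_cast hm
  obtain ⟨a, b, ha, hb, hpsi⟩ := exists_one_sub_two_mul_eq hd hd₁ σ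
  simp only [stepGen]
  rw [hpsi]
  set u : ℝ := 1 / 2 ^ d with hud
  have hm1 : RelApprox u 3 (fdiv d 1 m) (1 / m) :=
    (RelApprox.refl u 1).fdiv hd (RelApprox.refl u m)
  obtain ⟨t1, h1, e1⟩ := (RelApprox.refl u (-((m : ℝ) + 1))).fmul hd (RelApprox.refl u x)
  obtain ⟨t2, h2, e2⟩ := (hm1.fdiv hd (RelApprox.refl u 4)).fmul hd (RelApprox.refl u y)
  obtain ⟨t3, h3, e3⟩ := ((((RelApprox.refl u (a - 2 * σ * b)).fmul hd hm1).fdiv hd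
    (RelApprox.refl u 2)).fmul hd (RelApprox.refl u z))
  obtain ⟨p, q, hp, hq, e4⟩ := exists_fadd_eq hd (fmul d (-((m : ℝ) + 1)) x)
    (fmul d (fdiv d (fdiv d 1 m) 4) y)
  obtain ⟨r, s, hr, hs, e5⟩ := exists_fadd_eq hd
    (fadd d (fmul d (-((m : ℝ) + 1)) x) (fmul d (fdiv d (fdiv d 1 m) 4) y))
    (fmul d (fdiv d (fmul d (a - 2 * σ * b) (fdiv d 1 m)) 2) z)
  have key : ∀ {P : ℕ} {t : ℝ}, ErrFactor u P t → P ≤ 19 → |t - 1| ≤ 19 * u / (1 - 19 * u) := by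
    intro P t h hP
    have := (h.mono hu0 hu hP).abs_sub_one_le hu0 (by exact_mod_cast hu19) hu
    exact_mod_cast this
  have k1 := key ((h1.mul hu hp).mul hu hr) (by norm_num)
  have k2 := key ((h2.mul hu hq).mul hu hr) (by norm_num)
  have k3 := key ((h3.mul hu hs).mul hu ha) (by norm_num)
  have k4 := key ((h3.mul hu hs).mul hu hb) (by norm_num)
  rw [e5, e4, e1, e2, e3]
  have e : (-((m : ℝ) + 1) * x * t1 * p + 1 / m / 4 * y * t2 * q) * r
        + (a - 2 * σ * b) * (1 / m) / 2 * z * t3 * s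
        - (y / (4 * m) + (1 / 2 - σ) * (z / m) - ((m : ℝ) + 1) * x)
      = y / (4 * m) * (t2 * q * r - 1) + 1 / 2 * (z / m) * (t3 * s * a - 1)
        - σ * (z / m) * (t3 * s * b - 1) - (((m : ℝ) + 1) * x) * (t1 * p * r - 1) := by
    field_simp
    ring
  rw [e]
  generalize 19 * u / (1 - 19 * u) = δ at *
  calc _ ≤ |y / (4 * m)| * |t2 * q * r - 1| + |1 / 2 * (z / m)| * |t3 * s * a - 1|
        + |σ * (z / m)| * |t3 * s * b - 1| + |((m : ℝ) + 1) * x| * |t1 * p * r - 1| := by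
        rw [← abs_mul, ← abs_mul, ← abs_mul, ← abs_mul]
        exact (abs_sub _ _).trans (add_le_add_left ((abs_sub _ _).trans
          (add_le_add_left (abs_add_le _ _) _)) _)
    _ ≤ |y / (4 * m)| * δ + |1 / 2 * (z / m)| * δ + |σ * (z / m)| * δ
        + |((m : ℝ) + 1) * x| * δ := by gcongr
    _ = _ := by
        simp only [abs_mul, abs_div, abs_of_pos hm', abs_of_pos (show 0 < (m : ℝ) + 1 by linarith)]
        norm_num
        ring

theorem IsFactorialRoutine.relApprox {fac : ℕ → ℕ → ℝ} (h : IsFactorialRoutine fac) (hd : 1 ≤ d)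
    (j : ℕ) : RelApprox (1 / 2 ^ d) 1 (fac d j) (j.factorial : ℝ) := by
  refine RelApprox.of_abs_sub_le (unit_pos d).le (unit_lt_one hd) ((h d j hd).trans (le_of_eq ?_))
  rw [abs_of_nonneg (by positivity)]
  ring

/-- A summand carries 14 errors when formed, two of them from `fac`, and each subtraction adds at
most 2. -/
theorem exists_foldl_eq {fac : ℕ → ℕ → ℝ} (hfac : IsFactorialRoutine fac) (hd : 1 ≤ d)
    (k : ℕ) (v : ℤ → ℝ) (i : ℕ) : ∃ t : ℕ → ℝ, (∀ r, ErrFactor (1 / 2 ^ d) (14 + 2 * i) (t r)) ∧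
      (List.range i).foldl
        (fun (acc : ℝ) (r : ℕ) => fsub d acc (fmul d ((-1) ^ (k - r))
          (fmul d (v (r : ℤ)) (fdiv d (fmul d 1 (fac d (2 * k - 2 * r))) (fac d (k - r)))))) 0
      = -∑ r ∈ Finset.range i, (-1 : ℝ) ^ (k - r) * v r
          * (((2 * (k - r)).factorial : ℝ) / ((k - r).factorial : ℝ)) * t r := by
  have hu := unit_lt_one hd
  have hu0 := (unit_pos d).le
  induction i with
  | zero => exact ⟨fun _ => 1, fun _ => (ErrFactor.one _).mono hu0 hu (by omega), by simp⟩
  | succ i ih =>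
    obtain ⟨t, ht, e⟩ := ih
    rw [List.range_succ, List.foldl_append, e]
    simp only [List.foldl_cons, List.foldl_nil]
    obtain ⟨w, hw, ew⟩ := (RelApprox.refl (1 / 2 ^ d) ((-1 : ℝ) ^ (k - i))).fmul hd
      ((RelApprox.refl (1 / 2 ^ d) (v i)).fmul hd
        (((RelApprox.refl (1 / 2 ^ d) 1).fmul hd (hfac.relApprox hd (2 * k - 2 * i))).fdiv hd
          (hfac.relApprox hd (k - i))))
    rw [ew]
    obtain ⟨p, q, hp, hq, es⟩ := exists_fsub_eq hd
      (-∑ r ∈ Finset.range i, (-1 : ℝ) ^ (k - r) * v r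
          * (((2 * (k - r)).factorial : ℝ) / ((k - r).factorial : ℝ)) * t r)
      ((-1) ^ (k - i) * (v i * (1 * ((2 * k - 2 * i).factorial : ℝ) / ((k - i).factorial : ℝ))) * w)
    rw [es]
    refine ⟨fun r => if r = i then w * q else t r * p, fun r => ?_, ?_⟩
    · dsimp only
      split_ifs
      · exact (hw.mul hu hq).mono hu0 hu (by omega)
      · exact ((ht r).mul hu hp).mono hu0 hu (by omega)
    · dsimp only
      rw [Finset.sum_range_succ, if_pos rfl]
      have : ∑ r ∈ Finset.range i, (-1 : ℝ) ^ (k - r) * v r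
          * (((2 * (k - r)).factorial : ℝ) / ((k - r).factorial : ℝ))
            * (if r = i then w * q else t r * p)
          = (∑ r ∈ Finset.range i, (-1 : ℝ) ^ (k - r) * v r
          * (((2 * (k - r)).factorial : ℝ) / ((k - r).factorial : ℝ)) * t r) * p := by
        rw [Finset.sum_mul]
        refine Finset.sum_congr rfl fun r hr => ?_
        rw [if_neg (by have := Finset.mem_range.mp hr; omega)]
        ring
      rw [this, Nat.mul_sub]
      ring

theorem abs_stepLast_sub_le {fac : ℕ → ℕ → ℝ} (hfac : IsFactorialRoutine fac) (hd : 1 ≤ d)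
    (k : ℕ) (v : ℤ → ℝ) (hu : (14 + 2 * k : ℕ) * (1 / 2 ^ d : ℝ) < 1) :
    |stepLast d fac k v - -∑ r ∈ Finset.range k, (-1 : ℝ) ^ (k - r) * v r
          * (((2 * (k - r)).factorial : ℝ) / ((k - r).factorial : ℝ))|
      ≤ (14 + 2 * k : ℕ) * (1 / 2 ^ d) / (1 - (14 + 2 * k : ℕ) * (1 / 2 ^ d))
        * ∑ r ∈ Finset.range k, |v r|
          * (((2 * (k - r)).factorial : ℝ) / ((k - r).factorial : ℝ)) := by
  obtain ⟨t, ht, e⟩ := exists_foldl_eq hfac hd k v k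
  simp only [stepLast]
  rw [e, neg_sub_neg, ← Finset.sum_sub_distrib, Finset.mul_sum]
  refine (Finset.abs_sum_le_sum_abs _ _).trans (Finset.sum_le_sum fun r _ => ?_)
  have h := (ht r).abs_sub_one_le (unit_pos d).le hu (unit_lt_one hd)
  generalize ((14 + 2 * k : ℕ) : ℝ) * (1 / 2 ^ d) / (1 - (14 + 2 * k : ℕ) * (1 / 2 ^ d)) = δ at *
  generalize hF : (((2 * (k - r)).factorial : ℝ) / ((k - r).factorial : ℝ)) = F
  have hF0 : 0 ≤ F := by rw [← hF]; positivity
  rw [show (-1 : ℝ) ^ (k - r) * v r * F - (-1 : ℝ) ^ (k - r) * v r * F * t r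
    = -((-1 : ℝ) ^ (k - r) * v r * F * (t r - 1)) by ring]
  rw [abs_neg, abs_mul, abs_mul, abs_mul, abs_pow, abs_neg, abs_one, one_pow, one_mul,
    abs_of_nonneg hF0, mul_comm δ]
  gcongr

end Ops

theorem isRepresentable_stepLast (d : ℕ) (fac : ℕ → ℕ → ℝ) (k : ℕ) (v : ℤ → ℝ) :
    IsRepresentable (stepLast d fac k v) := by
  rw [stepLast]
  cases k with
  | zero => exact isRepresentable_zero
  | succ k =>
    rw [List.range_succ, List.foldl_append]
    exact isRepresentable_rnd _ _

theorem isRepresentable_computedRow (d : ℕ) (fac : ℕ → ℕ → ℝ) (psigma : ℝ) (n : ℕ)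
    (prev : ℤ → ℝ) (k : ℤ) : IsRepresentable (computedRow d fac psigma n prev k) := by
  simp only [computedRow]
  split_ifs
  · exact isRepresentable_stepLast _ _ _ _
  · exact isRepresentable_rnd _ _
  · exact isRepresentable_zero

theorem isRepresentable_dComputed (σ a ε₄ : ℝ) (L : ℕ) (fac : ℕ → ℕ → ℝ) (n : ℕ) (k : ℤ) :
    IsRepresentable (dComputed σ a ε₄ L fac n k) := by
  cases n with
  | zero =>
    simp only [dComputed]
    split_ifs
    · exact isRepresentable_one
    · exact isRepresentable_zero
  | succ n => exact isRepresentable_computedRow _ _ _ _ _ _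

/-! ### The tolerances and the working precision -/

/-- The tolerances `gammaTol a ε₄ n k`, up to the weights. -/
def tolSize (a ε₄ : ℝ) (n : ℕ) : ℝ :=
  √(2 * Real.pi) / 128 * ε₄ * (8 * √(Real.pi * a ^ 2 / 8)) ^ n

theorem rpow_half_natCast {x : ℝ} (hx : 0 ≤ x) (n : ℕ) : x ^ ((n : ℝ) / 2) = √x ^ n := by
  rw [Real.rpow_div_two_eq_sqrt _ hx, Real.rpow_natCast]

section Parameters

variable {a ε₄ : ℝ}

theorem tolSize_pos (ha : 0 < a) (hε : 0 < ε₄) (n : ℕ) : 0 < tolSize a ε₄ n := by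
  have := Real.pi_pos
  rw [tolSize]
  positivity

/-- The only loss is the replacement of (2/5)^m by (1/2)^m. -/
theorem tolSize_mul_wt_le (ha : 0 < a) (hε : 0 < ε₄) {n : ℕ} {k : ℤ} (hk : 2 * k ≤ 3 * (n : ℤ)) :
    tolSize a ε₄ n * wt (3 * n - 2 * k) ≤ gammaTol a ε₄ n k := by
  have hm : (0 : ℤ) ≤ 3 * n - 2 * k := by omega
  have hG := Gamma_half_pos hm
  rw [wt_of_nonneg hm, gammaTol, rpow_half_natCast (by have := Real.pi_pos; positivity), tolSize]
  have e : (((3 * n - 2 * k : ℤ) : ℝ) + 1) / 2 = (3 * (n : ℝ) - 2 * k + 1) / 2 := by push_cast; ring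
  rw [e] at hG ⊢
  have h8 : (2 : ℝ) ^ (2 * k) = 8 ^ n * (1 / 2) ^ (3 * n - 2 * k : ℤ) := by
    rw [one_div, inv_zpow', show 2 * k = 3 * n + -(3 * n - 2 * k : ℤ) by ring,
      zpow_add₀ (by norm_num), zpow_mul, zpow_natCast]
    norm_num
  have h25 : (2 / 5 : ℝ) ^ (3 * n - 2 * k : ℤ) ≤ (1 / 2) ^ (3 * n - 2 * k : ℤ) := by
    lift (3 * n - 2 * k : ℤ) to ℕ using hm with m
    rw [zpow_natCast, zpow_natCast]
    exact pow_le_pow_left₀ (by norm_num) (by norm_num) m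
  rw [h8]
  calc _ = √(2 * Real.pi) / 128 * √(Real.pi * a ^ 2 / 8) ^ n
        * (8 ^ n * (2 / 5 : ℝ) ^ (3 * n - 2 * k : ℤ) * ε₄
          / Real.Gamma ((3 * (n : ℝ) - 2 * k + 1) / 2)) := by rw [mul_pow]; ring
    _ ≤ _ := by gcongr

theorem tolSize_succ_ge (ha : 0 < a) (hε : 0 < ε₄) (n : ℕ) :
    5 * a * tolSize a ε₄ n ≤ tolSize a ε₄ (n + 1) := by
  have h0 := (tolSize_pos ha hε n).le
  have h : 5 / 8 * a ≤ √(Real.pi * a ^ 2 / 8) := by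
    refine Real.le_sqrt_of_sq_le ?_
    nlinarith [Real.pi_gt_d2, sq_nonneg a]
  have e : tolSize a ε₄ (n + 1) = 8 * √(Real.pi * a ^ 2 / 8) * tolSize a ε₄ n := by
    rw [tolSize, tolSize, pow_succ]
    ring
  rw [e]
  exact mul_le_mul_of_nonneg_right (by linarith) h0

/-! ### The working precision -/

variable {σ : ℝ} {L : ℕ}

theorem wpd_spec (σ a ε₄ : ℝ) (L n : ℕ) :
    6 ≤ wpd σ a ε₄ L n ∧ 40 * (L : ℝ) ^ 2 < 2 ^ wpd σ a ε₄ L n ∧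
    (1 + |σ|) * (constA σ * 2 ^ 13 / ε₄)
      * (8 / (Real.pi * a ^ 2 * constB₁ σ ^ 2)) ^ ((n : ℝ) / 2)
      * √(Real.Gamma ((n : ℝ) - 1 / 2)) < 2 ^ wpd σ a ε₄ L n := by
  refine Nat.sInf_mem (s := {d : ℕ | 6 ≤ d ∧ 40 * (L : ℝ) ^ 2 < 2 ^ d ∧
    (1 + |σ|) * (constA σ * 2 ^ 13 / ε₄)
      * (8 / (Real.pi * a ^ 2 * constB₁ σ ^ 2)) ^ ((n : ℝ) / 2)
      * √(Real.Gamma ((n : ℝ) - 1 / 2)) < 2 ^ d}) ?_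
  obtain ⟨d₁, h₁⟩ := pow_unbounded_of_one_lt (40 * (L : ℝ) ^ 2) (one_lt_two)
  obtain ⟨d₂, h₂⟩ := pow_unbounded_of_one_lt ((1 + |σ|) * (constA σ * 2 ^ 13 / ε₄)
      * (8 / (Real.pi * a ^ 2 * constB₁ σ ^ 2)) ^ ((n : ℝ) / 2)
      * √(Real.Gamma ((n : ℝ) - 1 / 2))) (one_lt_two)
  refine ⟨6 + d₁ + d₂, by omega, h₁.trans_le ?_, h₂.trans_le ?_⟩ <;>
  exact pow_le_pow_right₀ (by norm_num) (by omega)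

/-- The ratio of consecutive terms is √(b(n - 1/2)) ≤ 1. -/
theorem rpow_half_mul_sqrt_Gamma_le {b : ℝ} (hb : 0 ≤ b) (n : ℕ) (hn : b * n ≤ 1) (hn1 : 1 ≤ n) :
    b ^ ((n : ℝ) / 2) * √(Real.Gamma ((n : ℝ) - 1 / 2))
      ≤ b ^ (((1 : ℕ) : ℝ) / 2) * √(Real.Gamma (((1 : ℕ) : ℝ) - 1 / 2)) := by
  induction n, hn1 using Nat.le_induction with
  | base => exact le_rfl
  | succ n hn1 ih =>
    have h1 : (1 : ℝ) ≤ n := by exact_mod_cast hn1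
    push_cast at hn
    refine le_trans ?_ (ih (by nlinarith))
    rw [rpow_half_natCast hb, rpow_half_natCast hb, pow_succ,
      show ((n + 1 : ℕ) : ℝ) - 1 / 2 = ((n : ℝ) - 1 / 2) + 1 by push_cast; ring,
      Real.Gamma_add_one (by linarith), Real.sqrt_mul (by linarith)]
    have h2 : √b * √((n : ℝ) - 1 / 2) ≤ 1 := by
      rw [← Real.sqrt_mul hb]
      exact Real.sqrt_le_one.mpr (by nlinarith)
    calc _ = √b ^ n * √(Real.Gamma ((n : ℝ) - 1 / 2)) * (√b * √((n : ℝ) - 1 / 2)) := by ring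
      _ ≤ √b ^ n * √(Real.Gamma ((n : ℝ) - 1 / 2)) * 1 := by gcongr
      _ = _ := mul_one _

/-- This makes `psigma`, computed once at `wpd[1]`, accurate enough for every row. -/
theorem wpd_le_wpd_one (ha : 0 < a) (hε : 0 < ε₄) (hL : 3 * (L : ℝ) < 2 * a ^ 2 / 25) {n : ℕ}
    (hn1 : 1 ≤ n) (hn : n < L) : wpd σ a ε₄ L n ≤ wpd σ a ε₄ L 1 := by
  obtain ⟨h1, h2, h3⟩ := wpd_spec σ a ε₄ L 1
  refine Nat.sInf_le ⟨h1, h2, lt_of_le_of_lt ?_ h3⟩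
  have hB := one_le_constB₁ σ
  have hn' : (n : ℝ) ≤ L := by exact_mod_cast hn.le
  have hA := constA_pos σ
  have hπ := Real.pi_gt_three
  have hB2 : 1 ≤ constB₁ σ ^ 2 := one_le_pow₀ hB
  have hden : 8 * (n : ℝ) ≤ Real.pi * a ^ 2 * constB₁ σ ^ 2 := by
    have h4 : 3 * a ^ 2 ≤ Real.pi * a ^ 2 := by gcongr
    have h5 : Real.pi * a ^ 2 * 1 ≤ Real.pi * a ^ 2 * constB₁ σ ^ 2 := by gcongr
    have h6 : (0 : ℝ) ≤ n := by positivity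
    linarith
  have hb : 8 / (Real.pi * a ^ 2 * constB₁ σ ^ 2) * n ≤ 1 := by
    rw [div_mul_eq_mul_div, div_le_one (by positivity)]
    exact hden
  have := rpow_half_mul_sqrt_Gamma_le (by positivity) n hb hn1
  rw [mul_assoc, mul_assoc ((1 + |σ|) * (constA σ * 2 ^ 13 / ε₄))]
  exact mul_le_mul_of_nonneg_left this (by positivity)

theorem factorial_le_sq_mul_Gamma {n : ℕ} (hn : 1 ≤ n) :
    (n.factorial : ℝ) ≤ (n : ℝ) ^ 2 * Real.Gamma ((n : ℝ) - 1 / 2) := by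
  have h1 : (1 : ℝ) ≤ n := by exact_mod_cast hn
  have h := Gamma_add_half_le (x := (n : ℝ) - 1 / 2) (by linarith)
  have hG : 0 < Real.Gamma ((n : ℝ) - 1 / 2) := Real.Gamma_pos_of_pos (by linarith)
  have hs : √((n : ℝ) - 1 / 2) ≤ n := Real.sqrt_le_iff.mpr ⟨by linarith, by nlinarith⟩
  rw [sub_add_cancel] at h
  rw [← Real.Gamma_nat_eq_factorial, Real.Gamma_add_one (by positivity)]
  calc _ ≤ (n : ℝ) * (√((n : ℝ) - 1 / 2) * Real.Gamma ((n : ℝ) - 1 / 2)) := by gcongr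
    _ ≤ (n : ℝ) * ((n : ℝ) * Real.Gamma ((n : ℝ) - 1 / 2)) := by gcongr
    _ = _ := by ring

/-- The working precision is large enough for the size of the coefficients. -/
theorem unit_mul_rowSize_le (ha : 0 < a) (hε : 0 < ε₄) {n : ℕ} (hn : 1 ≤ n) :
    1 / 2 ^ wpd σ a ε₄ L n * ((1 + |σ|) * (constA σ * rowSize (growth σ) n))
      ≤ 624 / 100000 * ((n : ℝ) * (√2 / 2) ^ n) * tolSize a ε₄ n := by
  obtain ⟨-, -, h⟩ := wpd_spec σ a ε₄ L n
  generalize hd : wpd σ a ε₄ L n = d at *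
  have hπ := Real.pi_pos
  have hA := constA_pos σ
  have hB : 0 < constB₁ σ := by linarith [one_le_constB₁ σ]
  have h1 : (1 : ℝ) ≤ n := by exact_mod_cast hn
  have hG : 0 < Real.Gamma ((n : ℝ) - 1 / 2) := Real.Gamma_pos_of_pos (by linarith)
  have hsG : 0 < √(Real.Gamma ((n : ℝ) - 1 / 2)) := Real.sqrt_pos.mpr hG
  set g := √(Real.Gamma ((n : ℝ) - 1 / 2)) with hg
  have hh : 0 < √(Real.pi * a ^ 2 / 8) := Real.sqrt_pos.mpr (by positivity)
  have hb : √(8 / (Real.pi * a ^ 2 * constB₁ σ ^ 2))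
      = (√(Real.pi * a ^ 2 / 8) * constB₁ σ)⁻¹ := by
    rw [show 8 / (Real.pi * a ^ 2 * constB₁ σ ^ 2)
      = (Real.pi * a ^ 2 / 8 * constB₁ σ ^ 2)⁻¹ by field_simp, Real.sqrt_inv,
      Real.sqrt_mul (by positivity), Real.sqrt_sq hB.le]
  rw [rpow_half_natCast (by positivity), hb] at h
  rw [tolSize, rowSize, growth]
  set h' := √(Real.pi * a ^ 2 / 8)
  have hfact : √(n.factorial : ℝ) ≤ n * g := by
    rw [hg]
    refine Real.sqrt_le_iff.mpr ⟨by positivity, ?_⟩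
    rw [mul_pow, Real.sq_sqrt hG.le]
    exact factorial_le_sq_mul_Gamma hn
  have hsp : 2506 / 1000 ≤ √(2 * Real.pi) :=
    Real.le_sqrt_of_sq_le (by nlinarith [Real.pi_gt_d4])
  have h2d : (0 : ℝ) < 2 ^ d := by positivity
  have hmain : 1 / 2 ^ d * ((1 + |σ|) * constA σ) * g ≤ ε₄ / 2 ^ 13 * (h' * constB₁ σ) ^ n := by
    rw [inv_pow] at h
    have h5 : (1 + |σ|) * (constA σ * 2 ^ 13 / ε₄) * ((h' * constB₁ σ) ^ n)⁻¹ * g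
        = ((1 + |σ|) * constA σ * g) / (ε₄ / 2 ^ 13 * (h' * constB₁ σ) ^ n) := by
      field_simp
    rw [h5, div_lt_iff₀ (by positivity)] at h
    have h6 : 1 / 2 ^ d * ((1 + |σ|) * constA σ) * g = ((1 + |σ|) * constA σ * g) / 2 ^ d := by ring
    rw [h6, div_le_iff₀ h2d]
    linarith
  calc _ = 1 / 2 ^ d * ((1 + |σ|) * constA σ) * (4 * √2 / constB₁ σ) ^ n * √(n.factorial : ℝ) := by
        ring
    _ ≤ 1 / 2 ^ d * ((1 + |σ|) * constA σ) * (4 * √2 / constB₁ σ) ^ n * (n * g) := by gcongr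
    _ = 1 / 2 ^ d * ((1 + |σ|) * constA σ) * g * ((4 * √2 / constB₁ σ) ^ n * n) := by ring
    _ ≤ ε₄ / 2 ^ 13 * (h' * constB₁ σ) ^ n * ((4 * √2 / constB₁ σ) ^ n * n) := by gcongr
    _ = ε₄ / 2 ^ 13 * n * ((h' * constB₁ σ) * (4 * √2 / constB₁ σ)) ^ n := by
        rw [mul_pow (h' * constB₁ σ)]; ring
    -- B₁ cancels between precision and growth rate. The tolerance grows by 8h' per row, which
    -- leaves the decaying factor (√2/2)^n.
    _ = ε₄ / 2 ^ 13 * n * ((√2 / 2) * (8 * h')) ^ n := by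
        congr 2
        field_simp
        ring
    _ = 1 / 2 ^ 13 * ((n : ℝ) * (√2 / 2) ^ n) * (ε₄ * (8 * h') ^ n) := by rw [mul_pow]; ring
    _ ≤ (624 / 100000 * (√(2 * Real.pi) / 128)) * ((n : ℝ) * (√2 / 2) ^ n)
        * (ε₄ * (8 * h') ^ n) := by
        gcongr
        linarith
    _ = _ := by ring

theorem sqrt_two_div_two_pow_sq (n : ℕ) : ((√2 / 2 : ℝ) ^ n) ^ 2 = 1 / 2 ^ n := by
  rw [← pow_mul, mul_comm, pow_mul, div_pow, Real.sq_sqrt (by norm_num),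
    show (2 / 2 ^ 2 : ℝ) = 1 / 2 by norm_num, one_div_pow]

/-- The maximum is at n = 3, where the squared integer inequality is an equality. -/
theorem natCast_mul_pow_le (n : ℕ) : (n : ℝ) * (√2 / 2) ^ n ≤ 1061 / 1000 := by
  have h : 8 * n ^ 2 ≤ 9 * 2 ^ n := by
    rcases lt_or_ge n 3 with hn | hn
    · interval_cases n <;> norm_num
    · induction n, hn using Nat.le_induction with
      | base => norm_num
      | succ n hn ih => rw [pow_succ 2 n]; nlinarith
  have h' : 8 * (n : ℝ) ^ 2 ≤ 9 * 2 ^ n := by exact_mod_cast h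
  refine le_of_sq_le_sq ?_ (by norm_num)
  rw [mul_pow, sqrt_two_div_two_pow_sq, mul_one_div, div_le_iff₀ (by positivity)]
  have : (0 : ℝ) < 2 ^ n := by positivity
  nlinarith

/-- Equality holds at n = 4. -/
theorem natCast_mul_natCast_mul_pow_le (n : ℕ) :
    (14 + 3 * (n : ℝ)) * (n * (√2 / 2) ^ n) ≤ 26 := by
  have h : ((14 + 3 * n) * n) ^ 2 ≤ 676 * 2 ^ n := by
    rcases lt_or_ge n 4 with hn | hn
    · interval_cases n <;> norm_num
    · induction n, hn using Nat.le_induction with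
      | base => norm_num
      | succ n hn ih =>
        have h1 : ((14 + 3 * (n + 1)) * (n + 1)) ^ 2 ≤ 2 * ((14 + 3 * n) * n) ^ 2 := by
          obtain ⟨j, rfl⟩ := Nat.exists_eq_add_of_le hn
          ring_nf
          nlinarith
        rw [pow_succ 2 n]
        linarith
  have h' : ((14 + 3 * (n : ℝ)) * n) ^ 2 ≤ 676 * 2 ^ n := by exact_mod_cast h
  refine le_of_sq_le_sq ?_ (by norm_num)
  rw [← mul_assoc, mul_pow, sqrt_two_div_two_pow_sq, mul_one_div, div_le_iff₀ (by positivity)]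
  linarith

end Parameters

/-! ### The error analysis -/

/-- The sum of the absolute values of the terms of one row, with `1 - 2σ` replaced by
`1 + 2|σ|`. -/
def rowMajorant (σ : ℝ) (m : ℝ) (x y z : ℝ) : ℝ :=
  |y| / (4 * m) + (1 / 2 + |σ|) * (|z| / m) + (m + 1) * |x|

theorem rowMajorant_add_le (σ : ℝ) {m : ℝ} (hm : 0 < m) (x y z x' y' z' : ℝ) :
    rowMajorant σ m (x + x') (y + y') (z + z') ≤ rowMajorant σ m x y z + rowMajorant σ m x' y' z' := by
  have hσ := abs_nonneg σ
  have h : rowMajorant σ m x y z + rowMajorant σ m x' y' z' = (|y| + |y'|) / (4 * m)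
      + (1 / 2 + |σ|) * ((|z| + |z'|) / m) + (m + 1) * (|x| + |x'|) := by
    simp only [rowMajorant]; ring
  rw [h, rowMajorant]
  gcongr <;> exact abs_add_le _ _

theorem abs_row_le (σ : ℝ) {m : ℝ} (hm : 0 < m) (x y z : ℝ) :
    |y / (4 * m) + (1 / 2 - σ) * (z / m) - (m + 1) * x| ≤ rowMajorant σ m x y z := by
  have hc : |1 / 2 - σ| ≤ 1 / 2 + |σ| := by
    refine (abs_sub _ _).trans ?_
    norm_num
  rw [rowMajorant]
  refine (abs_sub _ _).trans (add_le_add ((abs_add_le _ _).trans (add_le_add ?_ ?_)) ?_)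
  · rw [abs_div, abs_of_pos (show 0 < 4 * m by linarith)]
  · rw [abs_mul, abs_div, abs_of_pos hm]
    gcongr
  · rw [abs_mul, abs_of_pos (by linarith)]

section Majorant

variable {n : ℕ} {k : ℤ} {X : ℝ} {prev : ℤ → ℝ}

/-- The parameter η is the constant of the middle term, 283/100 in general and 5/4 for m ≥ 2; 2.7532
bounds 125/64 + 4/5. -/
theorem rowMajorant_le_of_second {σ η Y : ℝ} (hX : 0 ≤ X)
    (h : ∀ k, |prev k| ≤ X * wtHat (3 * n - 2 * k)) (h0 : ∀ k < 0, prev k = 0) (hk0 : 0 ≤ k)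
    (hk : 2 * k < 3 * ((n + 1 : ℕ) : ℤ)) (hY : Y = X * wt (3 * ((n + 1 : ℕ) : ℤ) - 2 * k))
    (h2 : |prev (k - 1)| ≤ η * Y * (3 * ((n : ℝ) + 1) - 2 * k)) :
    rowMajorant σ (3 * ((n : ℝ) + 1) - 2 * k) (prev (k - 2)) (prev k) (prev (k - 1))
      ≤ (27532 / 10000 * √(3 * ((n : ℝ) + 1) / 2) + (1 / 2 + |σ|) * η) * Y := by
  have hm : 0 < 3 * ((n : ℝ) + 1) - 2 * k := by
    have : (2 * k : ℝ) < 3 * ((n : ℝ) + 1) := by exact_mod_cast hk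
    linarith
  have t1 := abs_first_term_le hX h hk0 hk
  have t3 := abs_third_term_le hX h h0 hk.le
  have hY0 : 0 ≤ Y := by rw [hY]; exact mul_nonneg hX (wt_nonneg _)
  rw [← hY] at t1 t3
  rw [← div_le_iff₀ hm] at h2
  rw [← div_le_iff₀ (by linarith)] at t1
  have h2' : (1 / 2 + |σ|) * (|prev (k - 1)| / (3 * ((n : ℝ) + 1) - 2 * k))
      ≤ (1 / 2 + |σ|) * (η * Y) := by gcongr
  have hS := mul_nonneg (Real.sqrt_nonneg (3 * ((n : ℝ) + 1) / 2)) hY0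
  rw [rowMajorant]
  linarith

end Majorant

/-- The hypotheses on the data of the problem. -/
structure Admissible (σ a ε₄ : ℝ) (L : ℕ) : Prop where
  pos : 0 < a
  eps_pos : 0 < ε₄
  length_lt : 3 * (L : ℝ) < 2 * a ^ 2 / 25
  sigma_le : |σ| ≤ a / 2

section Main

variable {σ a ε₄ : ℝ} {L n : ℕ} {fac : ℕ → ℕ → ℝ}

/-- L ≥ 2 forces a² > 75, so 1/2 ≤ 0.058 a. -/
theorem Admissible.half_add_le (h : Admissible σ a ε₄ L) (hL : 2 ≤ L) :
    1 / 2 + |σ| ≤ 558 / 1000 * a := by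
  have h1 := h.length_lt
  have h2 := h.sigma_le
  have h3 := h.pos
  have hL' : (2 : ℝ) ≤ L := by exact_mod_cast hL
  have : 866 / 100 ≤ a := by
    refine le_of_sq_le_sq ?_ h3.le
    linarith
  linarith

theorem Admissible.sqrt_le (h : Admissible σ a ε₄ L) (hn : n + 1 < L) :
    √(3 * ((n : ℝ) + 1) / 2) ≤ a / 5 := by
  have h1 := h.length_lt
  have h3 := h.pos
  have hL' : (n : ℝ) + 1 ≤ L := by exact_mod_cast hn.le
  exact Real.sqrt_le_iff.mpr ⟨by linarith, by linarith⟩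

theorem one_le_wpd (σ a ε₄ : ℝ) (L n : ℕ) : 1 ≤ wpd σ a ε₄ L n :=
  le_trans (by norm_num) (wpd_spec σ a ε₄ L n).1

theorem natCast_sq_mul_unit_lt (σ a ε₄ : ℝ) (L n : ℕ) :
    40 * (L : ℝ) ^ 2 * (1 / 2 ^ wpd σ a ε₄ L n) < 1 := by
  have := (wpd_spec σ a ε₄ L n).2.1
  rw [mul_one_div, div_lt_one (by positivity)]
  exact this

theorem dComputed_of_neg (n : ℕ) {k : ℤ} (hk : k < 0) : dComputed σ a ε₄ L fac n k = 0 := by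
  cases n with
  | zero => simp [dComputed, hk.ne]
  | succ n =>
    simp only [dComputed, computedRow]
    rw [if_neg (by omega), if_neg (by omega)]

theorem dComputed_of_lt (n : ℕ) {k : ℤ} (hk : 3 * (n : ℤ) < 2 * k) :
    dComputed σ a ε₄ L fac n k = 0 := by
  cases n with
  | zero =>
    have : k ≠ 0 := by rintro rfl; simp at hk
    simp [dComputed, this]
  | succ n =>
    simp only [dComputed, computedRow]
    rw [if_neg (by omega), if_neg (by omega)]

theorem dComputed_succ_of_lt {k : ℤ} (hk0 : 0 ≤ k) (hk : 2 * k < 3 * ((n + 1 : ℕ) : ℤ)) :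
    dComputed σ a ε₄ L fac (n + 1) k
      = stepGen (wpd σ a ε₄ L (n + 1)) (psigmaVal σ a ε₄ L) (3 * ((n + 1 : ℕ) : ℤ) - 2 * k)
        (dComputed σ a ε₄ L fac n (k - 2)) (dComputed σ a ε₄ L fac n k)
        (dComputed σ a ε₄ L fac n (k - 1)) := by
  simp only [dComputed, computedRow]
  rw [if_neg (by omega), if_pos ⟨hk0, hk⟩]

theorem stepLast_congr (d : ℕ) (fac : ℕ → ℕ → ℝ) (k : ℕ) {v w : ℤ → ℝ}
    (h : ∀ r : ℕ, r < k → v r = w r) : stepLast d fac k v = stepLast d fac k w := by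
  simp only [stepLast]
  refine List.foldl_ext _ _ _ fun acc r hr => ?_
  rw [h r (List.mem_range.mp hr)]

theorem dComputed_last (k : ℕ) (hk : 2 * k = 3 * (n + 1)) :
    dComputed σ a ε₄ L fac (n + 1) k
      = stepLast (wpd σ a ε₄ L (n + 1)) fac k (dComputed σ a ε₄ L fac (n + 1)) := by
  conv_lhs => simp only [dComputed, computedRow]
  rw [if_pos (by exact_mod_cast hk), Int.toNat_natCast]
  refine stepLast_congr _ _ _ fun r hr => ?_
  have hne : ¬ 2 * (r : ℤ) = 3 * ((n + 1 : ℕ) : ℤ) := by push_cast; omega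
  simp only [dComputed, computedRow]
  rw [if_neg hne]

/-- The effect of rounding errors of the size of the coefficients on one row. -/
theorem unit_mul_le_of_majorant (h : Admissible σ a ε₄ L) {η Mc W : ℝ}
    (hη : 0 ≤ η) (hw : 0 ≤ W)
    (hMc : Mc ≤ (27532 / 10000 * √(3 * ((n : ℝ) + 1) / 2) + (1 / 2 + |σ|) * η)
      * (constA σ * rowSize (growth σ) n * W)) :
    1 / 2 ^ wpd σ a ε₄ L (n + 1) * Mc
      ≤ (33721 / 10000 + η) * (1319 / 1000000 * (tolSize a ε₄ (n + 1) * W)) := by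
  have hup := unit_pos (wpd σ a ε₄ L (n + 1))
  have hU := unit_mul_rowSize_le (σ := σ) (L := L) h.pos h.eps_pos (n := n + 1) (by omega)
  have hpow := natCast_mul_pow_le (n + 1)
  have hC' := tolSize_pos h.pos h.eps_pos (n + 1)
  have hA := constA_pos σ
  have hK := growth_ge σ
  have hR := rowSize_nonneg (K := growth σ) (by linarith) n
  have hRR := rowSize_succ (growth σ) n
  have hS := sqrt_three_halves_le n
  have hs : 1 ≤ √((n : ℝ) + 1) :=
    Real.one_le_sqrt.mpr (by have : (0 : ℝ) ≤ n := by positivity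
                             linarith)
  have hσ0 := abs_nonneg σ
  generalize (1 / 2 ^ wpd σ a ε₄ L (n + 1) : ℝ) = u at *
  generalize tolSize a ε₄ (n + 1) = C' at *
  have h2 : 27532 / 10000 * √(3 * ((n : ℝ) + 1) / 2) + (1 / 2 + |σ|) * η
      ≤ (33721 / 10000 + η) * ((1 + |σ|) * √((n : ℝ) + 1)) := by
    have h3 : (1 / 2 + |σ|) * η * 1 ≤ (1 + |σ|) * η * √((n : ℝ) + 1) := by
      gcongr
      linarith
    have h4 : 0 ≤ |σ| * √((n : ℝ) + 1) := by positivity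
    linarith
  have h1 : Mc ≤ (33721 / 10000 + η) * ((1 + |σ|) * (√((n : ℝ) + 1)
      * (constA σ * rowSize (growth σ) n * W))) := by
    calc _ ≤ _ := hMc
      _ ≤ (33721 / 10000 + η) * ((1 + |σ|) * √((n : ℝ) + 1))
          * (constA σ * rowSize (growth σ) n * W) := by gcongr
      _ = _ := by ring
  -- The majorant of row n lacks one factor K of the size of row n + 1, which gains 1/5.0215.
  have h5 : √((n : ℝ) + 1) * rowSize (growth σ) n
      ≤ 10000 / 50215 * rowSize (growth σ) (n + 1) := by
    rw [hRR]
    have := mul_le_mul_of_nonneg_right hK (mul_nonneg (zero_le_one.trans hs) hR)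
    linarith
  have h6 : u * ((1 + |σ|) * (constA σ * rowSize (growth σ) (n + 1)))
      ≤ 624 / 100000 * (1061 / 1000) * C' := by
    refine hU.trans ?_
    gcongr
  calc u * Mc ≤ u * ((33721 / 10000 + η) * ((1 + |σ|) * (√((n : ℝ) + 1)
      * (constA σ * rowSize (growth σ) n * W)))) := by gcongr
    _ = (33721 / 10000 + η) * ((u * (1 + |σ|) * constA σ)
        * (√((n : ℝ) + 1) * rowSize (growth σ) n) * W) := by ring
    _ ≤ (33721 / 10000 + η) * ((u * (1 + |σ|) * constA σ)
        * (10000 / 50215 * rowSize (growth σ) (n + 1)) * W) := by gcongr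
    _ = (33721 / 10000 + η) * (10000 / 50215
        * (u * ((1 + |σ|) * (constA σ * rowSize (growth σ) (n + 1)))) * W) := by ring
    _ ≤ (33721 / 10000 + η) * (10000 / 50215 * (624 / 100000 * (1061 / 1000) * C') * W) := by
        gcongr
    _ ≤ _ := by
        refine mul_le_mul_of_nonneg_left ?_ (by positivity)
        have := mul_nonneg hC'.le hw
        linarith

/-- One step of the error analysis in the case `m ≠ 0`, with the factor `η` for the middle term. -/
theorem abs_dComputed_succ_sub_le_of_second (h : Admissible σ a ε₄ L) (hn : n + 1 < L)
    (ih : ∀ k, |dComputed σ a ε₄ L fac n k - dCoeff σ n k|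
      ≤ 49 / 100 * tolSize a ε₄ n * wtHat (3 * n - 2 * k)) {k : ℤ} (hk0 : 0 ≤ k)
    (hk : 2 * k < 3 * ((n + 1 : ℕ) : ℤ)) {η : ℝ} (hη : 0 ≤ η)
    (hsecond : ∀ (X : ℝ) (prev : ℤ → ℝ), 0 ≤ X → (∀ k, |prev k| ≤ X * wtHat (3 * n - 2 * k)) →
      |prev (k - 1)| ≤ η * (X * wt (3 * ((n + 1 : ℕ) : ℤ) - 2 * k))
      * (3 * ((n : ℝ) + 1) - 2 * k)) :
    |dComputed σ a ε₄ L fac (n + 1) k - dCoeff σ (n + 1) k|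
      ≤ (1113 / 10000 * (55064 / 100000 + 558 / 1000 * η) + 2849 / 100000 * (33721 / 10000 + η))
        * (tolSize a ε₄ (n + 1) * wt (3 * ((n + 1 : ℕ) : ℤ) - 2 * k)) := by
  have hLn : 2 ≤ L := by omega
  have hL2 : (2 : ℝ) ≤ L := by exact_mod_cast hLn
  have hd := one_le_wpd σ a ε₄ L (n + 1)
  have hd₁ : wpd σ a ε₄ L (n + 1) ≤ wpd σ a ε₄ L 1 :=
    wpd_le_wpd_one h.pos h.eps_pos h.length_lt (by omega) hn
  have hu1 := natCast_sq_mul_unit_lt σ a ε₄ L (n + 1)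
  have hup := unit_pos (wpd σ a ε₄ L (n + 1))
  have hC := tolSize_pos h.pos h.eps_pos n
  have hC' := tolSize_pos h.pos h.eps_pos (n + 1)
  have hCC := tolSize_succ_ge h.pos h.eps_pos n
  have hA := constA_pos σ
  have hK := growth_ge σ
  have hR := rowSize_nonneg (K := growth σ) (by linarith) n
  have hSa := h.sqrt_le hn
  have hσa := h.half_add_le hLn
  have ha := h.pos
  have hw := wt_nonneg (3 * ((n + 1 : ℕ) : ℤ) - 2 * k)
  have hm : 0 < 3 * ((n : ℝ) + 1) - 2 * k := by
    have : (2 * k : ℝ) < 3 * ((n : ℝ) + 1) := by exact_mod_cast hk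
    linarith
  set x := dComputed σ a ε₄ L fac n with hx
  set c := dCoeff σ n with hc
  -- The same estimate is applied to the errors of the stored row and, below, to the exact row; the
  -- stored values are bounded by their sum.
  have hMe := rowMajorant_le_of_second (σ := σ) (η := η) (prev := fun k => x k - c k)
    (by positivity) ih
    (fun k hk => by
      show x k - c k = 0
      rw [hx, hc, dComputed_of_neg _ hk, dCoeff_of_neg σ _ hk, sub_zero]) hk0 hk rfl
    (hsecond _ _ (by positivity) ih)
  have hcb : ∀ k, |c k| ≤ constA σ * rowSize (growth σ) n * wtHat (3 * n - 2 * k) := fun k => by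
    rw [mul_assoc]
    exact coeffBound σ n k
  have hMc := rowMajorant_le_of_second (σ := σ) (η := η) (prev := c) (by positivity) hcb
    (fun k hk => dCoeff_of_neg σ _ hk) hk0 hk rfl (hsecond _ _ (by positivity) hcb)
  have hMc' := unit_mul_le_of_majorant h hη hw hMc
  have hMx : rowMajorant σ (3 * ((n : ℝ) + 1) - 2 * k) (x (k - 2)) (x k) (x (k - 1))
      ≤ rowMajorant σ (3 * ((n : ℝ) + 1) - 2 * k) (x (k - 2) - c (k - 2)) (x k - c k)
        (x (k - 1) - c (k - 1))
      + rowMajorant σ (3 * ((n : ℝ) + 1) - 2 * k) (c (k - 2)) (c k) (c (k - 1)) := by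
    have := rowMajorant_add_le σ hm (x (k - 2) - c (k - 2)) (x k - c k) (x (k - 1) - c (k - 1))
      (c (k - 2)) (c k) (c (k - 1))
    simpa only [sub_add_cancel] using this
  have hrow := abs_row_le σ hm (x (k - 2) - c (k - 2)) (x k - c k) (x (k - 1) - c (k - 1))
  have hMc0 := (abs_nonneg _).trans (abs_row_le σ hm (c (k - 2)) (c k) (c (k - 1)))
  have hstep := abs_stepGen_sub_le hd hd₁ (by nlinarith) σ
    (m := 3 * ((n + 1 : ℕ) : ℤ) - 2 * k) (by omega) (x (k - 2)) (x k) (x (k - 1))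
  rw [show (((3 * ((n + 1 : ℕ) : ℤ) - 2 * k : ℤ)) : ℝ) = 3 * ((n : ℝ) + 1) - 2 * k by
    push_cast; ring] at hstep
  rw [dComputed_succ_of_lt hk0 hk, dCoeff_succ_of_lt σ n hk0 hk, psigmaVal]
  generalize stepGen (wpd σ a ε₄ L (n + 1)) _ _ _ _ _ = comp at *
  generalize (1 / 2 ^ wpd σ a ε₄ L (n + 1) : ℝ) = u at *
  generalize wt (3 * ((n + 1 : ℕ) : ℤ) - 2 * k) = W at *
  generalize tolSize a ε₄ n = C at *
  generalize tolSize a ε₄ (n + 1) = C' at *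
  -- From 40 L² u < 1 and L ≥ 2. Then 19/(1 - 19/160) < 21.561.
  have hu160 : 160 * u < 1 := by nlinarith
  have hδ : 19 * u / (1 - 19 * u) ≤ 21561 / 1000 * u := by
    rw [div_le_iff₀ (by linarith)]
    nlinarith
  have hδ0 : 0 ≤ 19 * u / (1 - 19 * u) := div_nonneg (by linarith) (by linarith)
  change _ ≤ 19 * u / (1 - 19 * u)
    * rowMajorant σ (3 * ((n : ℝ) + 1) - 2 * k) (x (k - 2)) (x k) (x (k - 1)) at hstep
  generalize rowMajorant σ (3 * ((n : ℝ) + 1) - 2 * k) (x (k - 2)) (x k) (x (k - 1)) = Mx at *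
  generalize rowMajorant σ (3 * ((n : ℝ) + 1) - 2 * k) (c (k - 2)) (c k) (c (k - 1)) = Mc at *
  generalize rowMajorant σ (3 * ((n : ℝ) + 1) - 2 * k) (x (k - 2) - c (k - 2)) (x k - c k)
    (x (k - 1) - c (k - 1)) = Me at *
  generalize 19 * u / (1 - 19 * u) = δ at *
  have hMe' : Me ≤ 98 / 1000 * (55064 / 100000 + 558 / 1000 * η) * (C' * W) := by
    calc Me ≤ _ := hMe
      _ ≤ (27532 / 10000 * (a / 5) + 558 / 1000 * a * η) * (49 / 100 * C * W) := by gcongr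
      _ = 98 / 1000 * (55064 / 100000 + 558 / 1000 * η) * (5 * a * C * W) := by ring
      _ ≤ _ := by gcongr
  have hMe0 : 0 ≤ Me := (abs_nonneg _).trans hrow
  -- Split the error into the rounding errors of this row and the exact recurrence applied to the
  -- inherited errors.
  have e : comp - (c k / (4 * (3 * ((n : ℝ) + 1) - 2 * k))
        + (1 / 2 - σ) * (c (k - 1) / (3 * ((n : ℝ) + 1) - 2 * k))
        - (3 * ((n : ℝ) + 1) - 2 * k + 1) * c (k - 2))
      = (comp - (x k / (4 * (3 * ((n : ℝ) + 1) - 2 * k))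
        + (1 / 2 - σ) * (x (k - 1) / (3 * ((n : ℝ) + 1) - 2 * k))
        - (3 * ((n : ℝ) + 1) - 2 * k + 1) * x (k - 2)))
      + ((x k - c k) / (4 * (3 * ((n : ℝ) + 1) - 2 * k))
        + (1 / 2 - σ) * ((x (k - 1) - c (k - 1)) / (3 * ((n : ℝ) + 1) - 2 * k))
        - (3 * ((n : ℝ) + 1) - 2 * k + 1) * (x (k - 2) - c (k - 2))) := by ring
  rw [e]
  refine (abs_add_le _ _).trans ?_
  have h7 : δ * Mx ≤ δ * (Me + Mc) := by gcongr
  have h8 : δ * Me ≤ 13476 / 100000 * Me := by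
    gcongr
    linarith
  have h9 : δ * Mc ≤ 21561 / 1000 * u * Mc := by gcongr
  have hCW : 0 ≤ C' * W := mul_nonneg hC'.le hw
  have hηCW := mul_nonneg hη hCW
  linarith

theorem abs_dComputed_succ_sub_le (h : Admissible σ a ε₄ L) (hn : n + 1 < L)
    (ih : ∀ k, |dComputed σ a ε₄ L fac n k - dCoeff σ n k|
      ≤ 49 / 100 * tolSize a ε₄ n * wtHat (3 * n - 2 * k)) {k : ℤ} (hk0 : 0 ≤ k)
    (hk : 2 * k < 3 * ((n + 1 : ℕ) : ℤ)) :
    |dComputed σ a ε₄ L fac (n + 1) k - dCoeff σ (n + 1) k|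
      ≤ 49 / 100 * (tolSize a ε₄ (n + 1) * wt (3 * ((n + 1 : ℕ) : ℤ) - 2 * k)) := by
  refine (abs_dComputed_succ_sub_le_of_second h hn ih hk0 hk (η := 283 / 100) (by norm_num)
    fun X prev hX hp => abs_second_term_le hX hp hk).trans ?_
  exact mul_le_mul_of_nonneg_right (by norm_num)
    (mul_nonneg (tolSize_pos h.pos h.eps_pos _).le (wt_nonneg _))

/-- In rows of even index the entries before the last have even m ≥ 2. The sharper 29/100 leaves
room for the factor 16/9 of the sum at m = 0. -/
theorem abs_dComputed_succ_sub_le_of_two_le (h : Admissible σ a ε₄ L) (hn : n + 1 < L)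
    (ih : ∀ k, |dComputed σ a ε₄ L fac n k - dCoeff σ n k|
      ≤ 49 / 100 * tolSize a ε₄ n * wtHat (3 * n - 2 * k)) {k : ℤ} (hk0 : 0 ≤ k)
    (hk : 2 * k + 2 ≤ 3 * ((n + 1 : ℕ) : ℤ)) :
    |dComputed σ a ε₄ L fac (n + 1) k - dCoeff σ (n + 1) k|
      ≤ 29 / 100 * (tolSize a ε₄ (n + 1) * wt (3 * ((n + 1 : ℕ) : ℤ) - 2 * k)) := by
  refine (abs_dComputed_succ_sub_le_of_second h hn ih hk0 (by omega) (η := 5 / 4) (by norm_num)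
    fun X prev hX hp => abs_second_term_le_of_two_le hX hp hk).trans ?_
  exact mul_le_mul_of_nonneg_right (by norm_num)
    (mul_nonneg (tolSize_pos h.pos h.eps_pos _).le (wt_nonneg _))

theorem abs_dComputed_last_sub_le (hfac : IsFactorialRoutine fac) (h : Admissible σ a ε₄ L)
    (hn : n + 1 < L) (ih : ∀ k, |dComputed σ a ε₄ L fac n k - dCoeff σ n k|
      ≤ 49 / 100 * tolSize a ε₄ n * wtHat (3 * n - 2 * k)) {k : ℕ} (hk : 2 * k = 3 * (n + 1)) :
    |dComputed σ a ε₄ L fac (n + 1) k - dCoeff σ (n + 1) k|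
      ≤ 49 / 100 * (tolSize a ε₄ (n + 1) * wtHat 0) := by
  have hd := one_le_wpd σ a ε₄ L (n + 1)
  have hu1 := natCast_sq_mul_unit_lt σ a ε₄ L (n + 1)
  have hup := unit_pos (wpd σ a ε₄ L (n + 1))
  have hU := unit_mul_rowSize_le (σ := σ) (L := L) h.pos h.eps_pos (n := n + 1) (by omega)
  have hpow := natCast_mul_natCast_mul_pow_le (n + 1)
  have hC' := tolSize_pos h.pos h.eps_pos (n + 1)
  have hA := constA_pos σ
  have hR := rowSize_nonneg (K := growth σ) (by linarith [growth_ge σ]) (n + 1)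
  have hw := wt_pos le_rfl
  have hL3 : (3 : ℝ) ≤ L := by exact_mod_cast (by omega : 3 ≤ L)
  have hnL : (n : ℝ) + 1 + 1 ≤ L := by exact_mod_cast hn
  have hcast : ((14 + 2 * k : ℕ) : ℝ) = 14 + 3 * ((n + 1 : ℕ) : ℝ) := by
    rw [hk]; push_cast; ring
  have hlast := dComputed_last (σ := σ) (a := a) (ε₄ := ε₄) (L := L) (fac := fac) k hk
  set v := dComputed σ a ε₄ L fac (n + 1) with hv
  set c := dCoeff σ (n + 1) with hc
  have hidx : ∀ r : ℕ, 3 * ((n + 1 : ℕ) : ℤ) - 2 * r = 2 * ((k : ℤ) - r) := fun r => by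
    rw [mul_sub, show (2 * (k : ℤ)) = 3 * ((n + 1 : ℕ) : ℤ) by exact_mod_cast hk]
  have hS1 := sum_abs_mul_factorial_le (k := k) (v := fun r => v r - c r)
    (Y := 29 / 100 * tolSize a ε₄ (n + 1)) (by positivity) (fun r hr => by
      have := abs_dComputed_succ_sub_le_of_two_le h hn ih (k := r) (by positivity) (by omega)
      rwa [hidx, ← mul_assoc] at this)
  have hS2 := sum_abs_mul_factorial_le (k := k) (v := c)
    (Y := constA σ * rowSize (growth σ) (n + 1)) (by positivity) (fun r hr => by
      have := coeffBound σ (n + 1) r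
      rwa [hidx, wtHat_of_ne (by omega), ← mul_assoc] at this)
  -- As n + 1 ≤ L - 1, the count is at most 11 + 3L ≤ 2.224 L²; L = 3 is the critical case.
  have hpu : (14 + 3 * ((n + 1 : ℕ) : ℝ)) * (1 / 2 ^ wpd σ a ε₄ L (n + 1)) ≤ 556 / 10000 := by
    have h1 : (14 + 3 * ((n + 1 : ℕ) : ℝ)) ≤ 556 / 10000 * (40 * (L : ℝ) ^ 2) := by
      push_cast
      nlinarith
    nlinarith
  have hstep := abs_stepLast_sub_le hfac hd k v (by rw [hcast]; linarith)
  rw [hcast] at hstep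
  rw [hlast, hc, dCoeff_last σ n k hk, ← hc]
  generalize stepLast (wpd σ a ε₄ L (n + 1)) fac k v = comp at *
  have hF : ∀ r, 0 ≤ ((2 * (k - r)).factorial : ℝ) / ((k - r).factorial : ℝ) := fun r => by
    positivity
  have hsum : ∑ r ∈ Finset.range k, |v r|
        * (((2 * (k - r)).factorial : ℝ) / ((k - r).factorial : ℝ))
      ≤ ∑ r ∈ Finset.range k, |v r - c r|
        * (((2 * (k - r)).factorial : ℝ) / ((k - r).factorial : ℝ))
      + ∑ r ∈ Finset.range k, |c r|
        * (((2 * (k - r)).factorial : ℝ) / ((k - r).factorial : ℝ)) := by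
    rw [← Finset.sum_add_distrib]
    refine Finset.sum_le_sum fun r _ => ?_
    rw [← add_mul]
    refine mul_le_mul_of_nonneg_right ?_ (hF r)
    have := abs_add_le (v r - c r) (c r)
    rwa [sub_add_cancel] at this
  have hdiff : |(-∑ r ∈ Finset.range k, (-1 : ℝ) ^ (k - r) * v r
        * (((2 * (k - r)).factorial : ℝ) / ((k - r).factorial : ℝ)))
      - -∑ r ∈ Finset.range k, (-1 : ℝ) ^ (k - r) * c r
        * (((2 * (k - r)).factorial : ℝ) / ((k - r).factorial : ℝ))|
      ≤ ∑ r ∈ Finset.range k, |v r - c r|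
        * (((2 * (k - r)).factorial : ℝ) / ((k - r).factorial : ℝ)) := by
    rw [neg_sub_neg, ← Finset.sum_sub_distrib]
    refine (Finset.abs_sum_le_sum_abs _ _).trans (Finset.sum_le_sum fun r _ => ?_)
    rw [← sub_mul, ← mul_sub, abs_mul, abs_mul, abs_pow, abs_neg, abs_one, one_pow, one_mul,
      abs_of_nonneg (hF r), abs_sub_comm]
  have htri := abs_sub_le comp (-∑ r ∈ Finset.range k, (-1 : ℝ) ^ (k - r) * v r
        * (((2 * (k - r)).factorial : ℝ) / ((k - r).factorial : ℝ)))
        (-∑ r ∈ Finset.range k, (-1 : ℝ) ^ (k - r) * c r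
        * (((2 * (k - r)).factorial : ℝ) / ((k - r).factorial : ℝ)))
  refine htri.trans ((add_le_add hstep hdiff).trans ?_)
  have hS20 : 0 ≤ ∑ r ∈ Finset.range k, |c r|
        * (((2 * (k - r)).factorial : ℝ) / ((k - r).factorial : ℝ)) :=
    Finset.sum_nonneg fun r _ => mul_nonneg (abs_nonneg _) (hF r)
  have hS10 : 0 ≤ ∑ r ∈ Finset.range k, |v r - c r|
        * (((2 * (k - r)).factorial : ℝ) / ((k - r).factorial : ℝ)) :=
    Finset.sum_nonneg fun r _ => mul_nonneg (abs_nonneg _) (hF r)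
  generalize ∑ r ∈ Finset.range k, |v r|
        * (((2 * (k - r)).factorial : ℝ) / ((k - r).factorial : ℝ)) = Sv at *
  generalize ∑ r ∈ Finset.range k, |c r|
        * (((2 * (k - r)).factorial : ℝ) / ((k - r).factorial : ℝ)) = Sc at *
  generalize ∑ r ∈ Finset.range k, |v r - c r|
        * (((2 * (k - r)).factorial : ℝ) / ((k - r).factorial : ℝ)) = Se at *
  rw [wtHat_zero]
  have hp0 : 0 ≤ 14 + 3 * ((n + 1 : ℕ) : ℝ) := by positivity
  generalize (14 + 3 * ((n + 1 : ℕ) : ℝ)) = p at *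
  generalize (1 / 2 ^ wpd σ a ε₄ L (n + 1) : ℝ) = u at *
  generalize tolSize a ε₄ (n + 1) = C' at *
  generalize wt 0 = W at *
  generalize ((n + 1 : ℕ) : ℝ) * (√2 / 2) ^ (n + 1) = b at *
  have hpu0 : 0 ≤ p * u := mul_nonneg hp0 hup.le
  have hδ : p * u / (1 - p * u) ≤ 106 / 100 * (p * u) := by
    rw [div_le_iff₀ (by linarith)]
    nlinarith
  have hδ0 : 0 ≤ p * u / (1 - p * u) := div_nonneg hpu0 (by linarith)
  generalize p * u / (1 - p * u) = δ at *
  have hpR : p * u * (constA σ * rowSize (growth σ) (n + 1)) ≤ 16224 / 100000 * C' := by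
    have hσ0 := abs_nonneg σ
    calc _ = p * (u * (1 * (constA σ * rowSize (growth σ) (n + 1)))) := by ring
      _ ≤ p * (u * ((1 + |σ|) * (constA σ * rowSize (growth σ) (n + 1)))) := by
          gcongr
          linarith
      _ ≤ p * (624 / 100000 * b * C') := by gcongr
      _ = 624 / 100000 * (p * b) * C' := by ring
      _ ≤ 624 / 100000 * 26 * C' := by gcongr
      _ = _ := by ring
  have hδSc : δ * Sc ≤ 106 / 100 * (16 / 9) * (16224 / 100000 * C' * W) := by
    calc δ * Sc ≤ 106 / 100 * (p * u)
          * (16 / 9 * (constA σ * rowSize (growth σ) (n + 1) * W)) := by gcongr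
      _ = 106 / 100 * (16 / 9) * (p * u * (constA σ * rowSize (growth σ) (n + 1)) * W) := by ring
      _ ≤ _ := by gcongr
  have hδSe : δ * Se ≤ 59 / 1000 * Se := by
    gcongr
    linarith
  have hδS : δ * Sv ≤ δ * (Se + Sc) := by gcongr
  have hCW : 0 < C' * W := by positivity
  linarith

theorem abs_dComputed_sub_le (hfac : IsFactorialRoutine fac) (h : Admissible σ a ε₄ L)
    (n : ℕ) (hn : n < L) (k : ℤ) : |dComputed σ a ε₄ L fac n k - dCoeff σ n k|
      ≤ 49 / 100 * tolSize a ε₄ n * wtHat (3 * n - 2 * k) := by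
  have hT := fun n => (tolSize_pos h.pos h.eps_pos n).le
  induction n generalizing k with
  | zero =>
    have : 0 ≤ 49 / 100 * tolSize a ε₄ 0 * wtHat (3 * (0 : ℕ) - 2 * k) :=
      mul_nonneg (by linarith [hT 0]) (wtHat_nonneg _)
    simpa [dComputed, dCoeff] using this
  | succ n ih =>
    have ih' := ih (by omega)
    have h0 : 0 ≤ 49 / 100 * tolSize a ε₄ (n + 1) * wtHat (3 * (n + 1 : ℕ) - 2 * k) :=
      mul_nonneg (by linarith [hT (n + 1)]) (wtHat_nonneg _)
    rcases lt_or_ge k 0 with hk0 | hk0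
    · rw [dComputed_of_neg _ hk0, dCoeff_of_neg σ _ hk0, sub_zero, abs_zero]
      exact h0
    rcases lt_trichotomy (2 * k) (3 * ((n + 1 : ℕ) : ℤ)) with hk | hk | hk
    · refine (abs_dComputed_succ_sub_le h hn ih' hk0 hk).trans ?_
      rw [← mul_assoc]
      exact mul_le_mul_of_nonneg_left (wt_le_wtHat _) (by linarith [hT (n + 1)])
    · obtain ⟨j, rfl⟩ := Int.eq_ofNat_of_zero_le hk0
      rw [show 3 * ((n + 1 : ℕ) : ℤ) - 2 * (j : ℤ) = 0 by omega, mul_assoc]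
      exact abs_dComputed_last_sub_le hfac h hn ih' (by exact_mod_cast hk)
    · rw [dComputed_of_lt _ hk, dCoeff_of_lt σ _ hk, sub_zero, abs_zero]
      exact h0

end Main

end

end RiemannSiegel

theorem mainTheorem7 (t σ ε₄ : ℝ) (L : ℕ) (fac : ℕ → ℕ → ℝ)
    (ht : 0 < t) (hε : 0 < ε₄)
    (hL : 3 * (L : ℝ) < 2 * RiemannSiegel.rsA t ^ 2 / 25)
    (hσ : |σ| ≤ RiemannSiegel.rsA t / 2)
    (hfac : RiemannSiegel.IsFactorialRoutine fac)
    (n : ℕ) (hn : n < L) (k : ℤ) (hk₀ : 0 ≤ k) (hk : 2 * k ≤ 3 * (n : ℤ)) :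
    RiemannSiegel.IsRepresentable
        (RiemannSiegel.dComputed σ (RiemannSiegel.rsA t) ε₄ L fac n k) ∧
      |RiemannSiegel.dComputed σ (RiemannSiegel.rsA t) ε₄ L fac n k
          - RiemannSiegel.dCoeff σ n k|
        < RiemannSiegel.gammaTol (RiemannSiegel.rsA t) ε₄ n k := by
  have ha : 0 < RiemannSiegel.rsA t := Real.sqrt_pos.mpr (div_pos ht (by positivity))
  refine ⟨RiemannSiegel.isRepresentable_dComputed _ _ _ _ _ _ _, ?_⟩
  -- Removing the doubled weight costs a factor 2; 2 · 0.49 < 1 gives the strict inequality.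
  refine lt_of_lt_of_le (lt_of_le_of_lt
    (RiemannSiegel.abs_dComputed_sub_le hfac ⟨ha, hε, hL, hσ⟩ n hn k) ?_)
    (RiemannSiegel.tolSize_mul_wt_le ha hε hk)
  have h1 := RiemannSiegel.tolSize_pos ha hε n
  have h2 := RiemannSiegel.wt_pos (show 0 ≤ 3 * (n : ℤ) - 2 * k by omega)
  have h3 := RiemannSiegel.wtHat_le (3 * (n : ℤ) - 2 * k)
  nlinarith [mul_pos h1 h2, mul_le_mul_of_nonneg_left h3 h1.le]
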